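/- Let $k$ be an algebraically closed field and let $g, n \ge 0$ be integers with $3g-3+n \ge 0$. A \emph{curve of genus $g$} over $k$ is a proper, connected, reduced scheme $C$ over $k$, pure of dimension one, with arithmetic genus $1-\chi(\mathcal O_C) = g$ (proper one-dimensional algebraic spaces over $k$ are schemes). Let $\mathcal U_{g,n}(k)$ be the groupoid whose objects are tuples $(C,q_1,\dots,q_n)$ with $C$ a curve of genus $g$ over $k$ and $q_1,\dots,q_n \in C(k)$ arbitrary, and whose morphisms are the $k$-isomorphisms of curves taking markings to markings. Let $\mathscr E_{g,n}(k)$ be the groupoid of $n$-pointed equinormalized curves of genus $g$ over $k$. Its objects are tuples $(\nu:\tilde C\to C,\ p_1,\dots,p_n)$ where $C$ is a curve of genus $g$ over $k$; $\tilde C$ is a smooth proper $k$-scheme, pure of dimension one and possibly disconnected; $p_1,\dots,p_n\in\tilde C(k)$ are pairwise distinct; and $\nu$ is a finite $k$-morphism such that $\mathcal O_C\to\nu_*\mathcal O_{\tilde C}$ is injective, $\Delta=\nu_*\mathcal O_{\tilde C}/\mathcal O_C$ is supported on a closed subscheme of $C$ finite over $k$, and $\Gamma(C,\Delta)$ is finite-dimensional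 over $k$. Its morphisms are the pairs of $k$-isomorphisms $\tilde C\cong\tilde C'$, $C\cong C'$ compatible with $\nu,\nu'$ and taking $p_i$ to $p_i'$. Consider the functor $$F:\mathscr E_{g,n}(k)\to\mathcal U_{g,n}(k),\qquad (\nu:\tilde C\to C,\ p_1,\dots,p_n)\mapsto (C,\nu(p_1),\dots,\nu(p_n)).$$ 1. $F$ is finite-to-one on isomorphism classes: for every object $Y$ of $\mathcal U_{g,n}(k)$ there are only finitely many isomorphism classes of objects $X$ of $\mathscr E_{g,n}(k)$ with $F(X)\cong Y$. 2. Restricted to smooth markings, $F$ is an equivalence of categories: $F$ maps the full subcategory of those $(\nu,p_1,\dots,p_n)$ for which all $\nu(p_i)$ are smooth points of $C$ into the full subcategory of those $(C,q_1,\dots,q_n)$ for which $q_1,\dots,q_n$ are pairwise distinct smooth points of $C$, and the resulting functor between these full subcategories is an equivalence of categories. -/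

import Mathlib

open CategoryTheory AlgebraicGeometry TopologicalSpace

universe u

noncomputable section

namespace EquinormalizedCurves

section Sheaves

variable {k : Type u} [Field k]

/-- The ring homomorphism `k → Γ(X, U)` given by the structure morphism `π : X ⟶ Spec k`. -/
def scalars {X : Scheme.{u}} (π : X ⟶ Spec (.of k)) (U : X.Opens) : k →+* Γ(X, U) :=
  ((Scheme.ΓSpecIso (.of k)).inv ≫ π.appTop ≫ X.presheaf.map (homOfLE le_top).op).hom

lemma map_scalars {X : Scheme.{u}} (π : X ⟶ Spec (.of k)) {U V : X.Opens} (i : U ⟶ V) (c : k) :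
    (X.presheaf.map i.op).hom (scalars π V c) = scalars π U c := by
  have h : X.presheaf.map (homOfLE (le_top : V ≤ ⊤)).op ≫ X.presheaf.map i.op =
      X.presheaf.map (homOfLE (le_top : U ≤ ⊤)).op := by
    rw [← X.presheaf.map_comp]; rfl
  simp only [scalars, ← h]
  rfl

lemma app_scalars {X Y : Scheme.{u}} (πX : X ⟶ Spec (.of k)) (πY : Y ⟶ Spec (.of k))
    (f : X ⟶ Y) (hf : f ≫ πY = πX) (U : Y.Opens) (c : k) :
    (f.app U).hom (scalars πY U c) = scalars πX (f ⁻¹ᵁ U) c := by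
  subst hf
  have h : Y.presheaf.map (homOfLE (le_top : U ≤ ⊤)).op ≫ f.app U =
      f.appTop ≫ X.presheaf.map (homOfLE (le_top : f ⁻¹ᵁ U ≤ ⊤)).op :=
    f.naturality _
  have h2 : (Scheme.ΓSpecIso (.of k)).inv ≫ πY.appTop ≫
      Y.presheaf.map (homOfLE (le_top : U ≤ ⊤)).op ≫ f.app U =
      (Scheme.ΓSpecIso (.of k)).inv ≫ (f ≫ πY).appTop ≫
        X.presheaf.map (homOfLE (le_top : f ⁻¹ᵁ U ≤ ⊤)).op := by
    rw [h, Scheme.Hom.comp_appTop, Category.assoc]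
  have h3 := congrArg (fun g => g.hom c) h2
  exact h3

/-- The `k`-vector space `Γ(X, U)`. -/
def sections {X : Scheme.{u}} (π : X ⟶ Spec (.of k)) (U : X.Opens) : ModuleCat.{u} k :=
  letI : Module k Γ(X, U) := Module.compHom _ (scalars π U)
  ModuleCat.of k Γ(X, U)

/-- Restriction of functions `Γ(X, V) → Γ(X, U)`, as a `k`-linear map. -/
def restriction {X : Scheme.{u}} (π : X ⟶ Spec (.of k)) {U V : X.Opens} (i : U ⟶ V) :
    sections π V →ₗ[k] sections π U where
  toFun := (X.presheaf.map i.op).hom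
  map_add' := (X.presheaf.map i.op).hom.map_add
  map_smul' c x := by
    change (X.presheaf.map i.op).hom (scalars π V c * (show Γ(X, V) from x)) =
      scalars π U c * (X.presheaf.map i.op).hom x
    rw [map_mul, map_scalars π i c]

/-- The structure sheaf of a `k`-scheme, as a presheaf of `k`-vector spaces. -/
def structurePresheaf {X : Scheme.{u}} (π : X ⟶ Spec (.of k)) :
    TopCat.Presheaf (ModuleCat.{u} k) X where
  obj U := sections π U.unop
  map {U V} i := ModuleCat.ofHom (X := sections π U.unop) (Y := sections π V.unop)
    (restriction π i.unop)
  map_id U := by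
    refine ModuleCat.hom_ext (LinearMap.ext fun x => ?_)
    change (X.presheaf.map (𝟙 U)).hom x = x
    rw [X.presheaf.map_id]; rfl
  map_comp {U V W} i j := by
    refine ModuleCat.hom_ext (LinearMap.ext fun x => ?_)
    change (X.presheaf.map (i ≫ j)).hom x = (X.presheaf.map j).hom ((X.presheaf.map i).hom x)
    rw [X.presheaf.map_comp]; rfl

/-- The structure sheaf of a `k`-scheme, as a sheaf of `k`-vector spaces. -/
def structureSheaf {X : Scheme.{u}} (π : X ⟶ Spec (.of k)) :
    TopCat.Sheaf (ModuleCat.{u} k) X :=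
  ⟨structurePresheaf π, (TopCat.Presheaf.isSheaf_iff_isSheaf_comp (forget _) _).mpr
    (TopCat.Presheaf.isSheaf_of_iso
      (NatIso.ofComponents (F := X.presheaf ⋙ forget CommRingCat)
        (G := structurePresheaf π ⋙ forget (ModuleCat k)) (fun _ => Iso.refl _)
        (fun _ => by ext x; rfl))
      ((TopCat.Presheaf.isSheaf_iff_isSheaf_comp (forget CommRingCat) X.presheaf).mp
        X.sheaf.property))⟩

/-- `H⁰` as a functor: global sections of sheaves of `k`-vector spaces. -/
def globalSections (X : Scheme.{u}) :
    TopCat.Sheaf (ModuleCat.{u} k) X ⥤ ModuleCat.{u} k :=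
  TopCat.Sheaf.forget _ _ ⋙ (evaluation _ _).obj (.op ⊤)

instance (X : Scheme.{u}) : (globalSections (k := k) X).Additive where

/-- `hⁱ(X, 𝒪_X)`, the dimension of sheaf cohomology
(the right derived functors of global sections). -/
def cohomologyDim {X : Scheme.{u}} (π : X ⟶ Spec (.of k)) (i : ℕ) : ℕ :=
  Module.finrank k (((globalSections X).rightDerived i).obj (structureSheaf π))

/-- The arithmetic genus `1 - χ(𝒪_X) = 1 - h⁰(X, 𝒪_X) + h¹(X, 𝒪_X)` of a proper curve. -/
def arithmeticGenus {X : Scheme.{u}} (π : X ⟶ Spec (.of k)) : ℤ :=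
  1 - ((cohomologyDim π 0 : ℤ) - (cohomologyDim π 1 : ℤ))

/-- Pullback of functions `Γ(Y, U) → Γ(X, f⁻¹ U)`, as a `k`-linear map. -/
def pullbackSections {X Y : Scheme.{u}} (πX : X ⟶ Spec (.of k)) (πY : Y ⟶ Spec (.of k))
    (f : X ⟶ Y) (hf : f ≫ πY = πX) (U : Y.Opens) :
    sections πY U →ₗ[k] sections πX (f ⁻¹ᵁ U) where
  toFun := (f.app U).hom
  map_add' := (f.app U).hom.map_add
  map_smul' c x := by
    change (f.app U).hom (scalars πY U c * (show Γ(Y, U) from x)) =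
      scalars πX (f ⁻¹ᵁ U) c * (f.app U).hom x
    rw [map_mul, app_scalars πX πY f hf]

/-- The pullback of functions `𝒪_Y ⟶ f_* 𝒪_X`. -/
def sharp {X Y : Scheme.{u}} (πX : X ⟶ Spec (.of k)) (πY : Y ⟶ Spec (.of k))
    (f : X ⟶ Y) (hf : f ≫ πY = πX) :
    structureSheaf πY ⟶ (TopCat.Sheaf.pushforward _ f.base).obj (structureSheaf πX) :=
  ⟨{ app := fun U => ModuleCat.ofHom (X := sections πY U.unop) (Y := sections πX (f ⁻¹ᵁ U.unop))
      (pullbackSections πX πY f hf U.unop)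
     naturality := fun U V i => by
      refine ModuleCat.hom_ext (LinearMap.ext fun x => ?_)
      exact congrArg (fun g => g.hom (show Γ(Y, U.unop) from x)) (f.naturality i) }⟩

/-- The quotient sheaf `Δ = f_* 𝒪_X / 𝒪_Y`. -/
def Delta {X Y : Scheme.{u}} (πX : X ⟶ Spec (.of k)) (πY : Y ⟶ Spec (.of k))
    (f : X ⟶ Y) (hf : f ≫ πY = πX) : TopCat.Sheaf (ModuleCat.{u} k) Y :=
  Limits.cokernel (sharp πX πY f hf)

end Sheaves

/-- Every irreducible component has dimension one. -/
def PureOneDimensional (X : Type*) [TopologicalSpace X] : Prop :=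
  ∀ Z ∈ irreducibleComponents X, topologicalKrullDim Z = 1

/-- A proper, connected, reduced, pure one-dimensional curve of arithmetic genus `g` over an
algebraically closed field `k`. As `k` is algebraically closed, the only fibre of `π` is a geometric
one, so that the conditions on geometric fibres are conditions on `C`. -/
structure Curve (k : Type u) [Field k] [IsAlgClosed k] (g : ℕ) where
  C : Scheme.{u}
  π : C ⟶ Spec (.of k)
  [flat : Flat π]
  [proper : IsProper π]
  [finitePresentation : LocallyOfFinitePresentation π]
  [connected : ConnectedSpace C]
  [reduced : IsReduced C]
  pure : PureOneDimensional C
  genus : arithmeticGenus π = g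

attribute [instance] Curve.flat Curve.proper Curve.finitePresentation Curve.connected
  Curve.reduced

/-- The objects of `𝒰_{g,n}(k)`: curves of arithmetic genus `g` with `n` arbitrary `k`-points. -/
structure PointedCurve (k : Type u) [Field k] [IsAlgClosed k] (g n : ℕ) extends Curve k g where
  q : Fin n → (Spec (.of k) ⟶ C)
  q_π : ∀ i, q i ≫ π = 𝟙 _

namespace PointedCurve

variable {k : Type u} [Field k] [IsAlgClosed k] {g n : ℕ}

/-- Isomorphisms of pointed curves over `k`. -/
@[ext]
structure Hom (X Y : PointedCurve k g n) where
  iso : X.C ≅ Y.C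
  iso_π : iso.hom ≫ Y.π = X.π
  q_iso : ∀ i, X.q i ≫ iso.hom = Y.q i

instance : Category (PointedCurve k g n) where
  Hom := Hom
  id X := ⟨Iso.refl _, by simp, by simp⟩
  comp f h := ⟨f.iso ≪≫ h.iso, by simp [f.iso_π, h.iso_π],
    fun i => by rw [Iso.trans_hom, ← Category.assoc, f.q_iso, h.q_iso]⟩
  id_comp f := Hom.ext (by simp)
  comp_id f := Hom.ext (by simp)
  assoc f h l := Hom.ext (by simp)

/-- All markings lie in the smooth locus of `C`. -/
def SmoothMarkings (X : PointedCurve k g n) : Prop :=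
  ∀ i, Set.range (X.q i) ⊆ (X.π.smoothLocus : Set X.C)

/-- The markings are pairwise disjoint, that is, pairwise distinct points of `C`. -/
def DistinctMarkings (X : PointedCurve k g n) : Prop :=
  Pairwise fun i j => Disjoint (Set.range (X.q i)) (Set.range (X.q j))

end PointedCurve

/-- The objects of `ℰ_{g,n}(k)`: `n`-pointed equinormalized curves of genus `g` over `k`. -/
structure EquinormalizedCurve (k : Type u) [Field k] [IsAlgClosed k] (g n : ℕ)
    extends Curve k g where
  Ct : Scheme.{u}
  πt : Ct ⟶ Spec (.of k)
  [smooth_t : Smooth πt]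
  [proper_t : IsProper πt]
  pure_t : PureOneDimensional Ct
  p : Fin n → (Spec (.of k) ⟶ Ct)
  p_πt : ∀ i, p i ≫ πt = 𝟙 _
  disjoint : Pairwise fun i j => Disjoint (Set.range (p i)) (Set.range (p j))
  ν : Ct ⟶ C
  ν_π : ν ≫ π = πt
  /-- `ν` is finite (equivalently, it contracts no component of `C̃` to a point). -/
  [finite_ν : IsFinite ν]
  /-- `𝒪_C ⟶ ν_* 𝒪_C̃` is injective. -/
  injective : ∀ U : C.Opens, Function.Injective (ν.app U)
  /-- `Δ` is supported on a closed subscheme of `C` that is finite over `k`. -/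
  support : ∃ (Z : Scheme.{u}) (i : Z ⟶ C), IsClosedImmersion i ∧ IsFinite (i ≫ π) ∧
    ∀ x ∉ Set.range i, Subsingleton ((Delta πt π ν ν_π).presheaf.stalk x)
  /-- `π_* Δ` is of finite rank. -/
  finite_Delta : Module.Finite k ((globalSections C).obj (Delta πt π ν ν_π))

attribute [instance] EquinormalizedCurve.smooth_t EquinormalizedCurve.proper_t
  EquinormalizedCurve.finite_ν

namespace EquinormalizedCurve

variable {k : Type u} [Field k] [IsAlgClosed k] {g n : ℕ}

/-- Isomorphisms of equinormalized curves over `k`. -/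
@[ext]
structure Hom (X Y : EquinormalizedCurve k g n) where
  iso_t : X.Ct ≅ Y.Ct
  iso : X.C ≅ Y.C
  iso_πt : iso_t.hom ≫ Y.πt = X.πt
  iso_π : iso.hom ≫ Y.π = X.π
  iso_ν : iso_t.hom ≫ Y.ν = X.ν ≫ iso.hom
  p_iso : ∀ i, X.p i ≫ iso_t.hom = Y.p i

instance : Category (EquinormalizedCurve k g n) where
  Hom := Hom
  id X := ⟨Iso.refl _, Iso.refl _, by simp, by simp, by simp, by simp⟩
  comp f h := ⟨f.iso_t ≪≫ h.iso_t, f.iso ≪≫ h.iso, by simp [f.iso_πt, h.iso_πt],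
    by simp [f.iso_π, h.iso_π],
    by rw [Iso.trans_hom, Iso.trans_hom, Category.assoc, h.iso_ν, ← Category.assoc, f.iso_ν,
      Category.assoc],
    fun i => by rw [Iso.trans_hom, ← Category.assoc, f.p_iso, h.p_iso]⟩
  id_comp f := Hom.ext (by simp) (by simp)
  comp_id f := Hom.ext (by simp) (by simp)
  assoc f h l := Hom.ext (by simp) (by simp)

variable (k g n) in
/-- The functor `ℰ_{g,n}(k) ⥤ 𝒰_{g,n}(k)` taking `(ν : C̃ → C, pᵢ)` to `(C, ν(pᵢ))`. -/
def toPointedCurve : EquinormalizedCurve k g n ⥤ PointedCurve k g n where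
  obj X :=
    { toCurve := X.toCurve
      q := fun i => X.p i ≫ X.ν
      q_π := fun i => by rw [Category.assoc, X.ν_π, X.p_πt] }
  map {X Y} f :=
    { iso := f.iso
      iso_π := f.iso_π
      q_iso := fun i => by
        rw [Category.assoc, ← f.iso_ν, ← Category.assoc, f.p_iso] }
  map_id _ := rfl
  map_comp _ _ := rfl

end EquinormalizedCurve

variable (k : Type u) [Field k] [IsAlgClosed k] (g n : ℕ)

/-- Equinormalized curves whose markings `ν(pᵢ)` are smooth points of `C`. -/
def smoothE : ObjectProperty (EquinormalizedCurve k g n) :=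
  fun X => ((EquinormalizedCurve.toPointedCurve k g n).obj X).SmoothMarkings

/-- Pointed curves whose markings are pairwise distinct smooth points of `C`. -/
def smoothU : ObjectProperty (PointedCurve k g n) :=
  fun X => X.SmoothMarkings ∧ X.DistinctMarkings

end EquinormalizedCurves

end

noncomputable section

namespace EquinormalizedCurves

/-! ### Smooth algebras over a field are reduced and normal -/

section Normality

open TensorProduct nonZeroDivisors

/-! The morphism `ν` of an equinormalized curve is the normalization of `C`, so the only extra datum
is the choice of the points `p i` over the markings. Off the support of `Δ`, which consists of
finitely many closed points, `ν` is an isomorphism, and the preimage of this open set is dense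
because `C̃` is pure of dimension one. A smooth scheme is normal, being locally étale over affine
space, so integral functions extend from dense open sets. Hence `C̃` is the relative normalization
of `C` in such an open set (`exists_normalization_iso`), isomorphisms of curves lift
(`EquinormalizedCurve.exists_iso`), and `ν` is an isomorphism over the smooth locus
(`isIso_morphismRestrict_smoothLocus`). Lifts are unique because `ν` is separated and an isomorphism
over a dense open set.

For finiteness, fix one object over `Y`. Every other one is identified with it up to the markings,
which lie in finite fibres of `ν`. Over smooth points these fibres are singletons, which gives
fullness and the distinctness of the images.

Essential surjectivity asks that the normalization of `C` in its dense smooth locus be an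
equinormalized curve. It is finite over `C` by Noether normalization, with Frobenius treating the
inseparable part (`finite_integralClosure_of_isDomain`). It is smooth because in dimension one
integral closedness yields a local parameter (`exists_local_generator`), and a local parameter is a
map to the affine line that is étale at the point (`isSmoothAt_of_local_generator`). Finally `Δ`
lives at the finitely many nonsmooth points, where its stalks are finite-dimensional
(`finite_stalk_Delta`). -/

/-- An étale algebra over a normal domain is integrally closed in its localizations at
nonzerodivisors. -/
lemma exists_algebraMap_eq_of_isIntegral_of_etale (R : Type*) {S L : Type*} [CommRing R] [IsDomain R]
    [IsIntegrallyClosed R] [CommRing S] [Algebra R S] [Algebra.Etale R S] {s : S} (hs : s ∈ S⁰)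
    [CommRing L] [Algebra S L] [IsLocalization.Away s L] {x : L} (hx : IsIntegral S x) :
    ∃ y : S, algebraMap S L y = x := by
  let K := FractionRing R
  have : Module.Finite K (K ⊗[R] S) := Algebra.FormallyUnramified.finite_of_free _ _
  have : IsArtinianRing (K ⊗[R] S) := IsArtinianRing.of_finite K _
  have : IsArtinianRing (S ⊗[R] K) :=
    let e : K ⊗[R] S ≃ₐ[R] S ⊗[R] K := Algebra.TensorProduct.comm R K S
    Function.Surjective.isArtinianRing (f := e.toRingEquiv.toRingHom) e.surjective
  have hinj : Function.Injective (algebraMap S (S ⊗[R] K)) :=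
    Algebra.TensorProduct.includeLeft_injective (S := R) (IsFractionRing.injective R K)
  -- Flatness keeps `s` a nonzerodivisor in the generic fibre, and in an Artinian ring it is then a
  -- unit. So `L` embeds in `S ⊗[R] K`.
  have hs' : algebraMap S (S ⊗[R] K) s ∈ (S ⊗[R] K)⁰ := by
    refine mem_nonZeroDivisors_iff_right.mpr fun z hz => ?_
    refine (Module.Flat.isSMulRegular_of_nonZeroDivisors (M := S ⊗[R] K) hs).right_eq_zero_of_smul ?_
    exact (Algebra.smul_def s z).trans ((mul_comm _ _).trans hz)
  have hunit : IsUnit (algebraMap S (S ⊗[R] K) s) :=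
    IsArtinianRing.isUnit_of_mem_nonZeroDivisors hs'
  let φ : L →ₐ[S] S ⊗[R] K := IsLocalization.liftAlgHom (M := Submonoid.powers s)
    (f := Algebra.ofId S (S ⊗[R] K)) (by
      rintro ⟨_, n, rfl⟩
      simpa [Algebra.ofId_apply] using hunit.pow n)
  have hφ : Function.Injective φ := by
    rw [injective_iff_map_eq_zero]
    intro z hz
    obtain ⟨n, a, e⟩ := IsLocalization.Away.surj s z
    have h1 : algebraMap S (S ⊗[R] K) a = 0 := by
      rw [← φ.commutes, ← e, map_mul, hz, zero_mul]
    rw [(injective_iff_map_eq_zero _).mp hinj a h1, map_zero] at e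
    exact ((IsLocalization.Away.algebraMap_isUnit s).pow n |>.mul_left_eq_zero).mp (by simpa using e)
  -- Integral closure commutes with smooth base change, so integral elements are sums of `a ⊗ b`
  -- with `b` integral over `R`; normality of `R` puts `b` in `R`.
  obtain ⟨y, hy⟩ := TensorProduct.toIntegralClosure_bijective_of_smooth.2
    (⟨φ x, hx.map φ⟩ : integralClosure S (S ⊗[R] K))
  have hy' : (toIntegralClosure R S K y : S ⊗[R] K) = φ x := congrArg Subtype.val hy
  suffices h : (toIntegralClosure R S K y : S ⊗[R] K) ∈ (algebraMap S (S ⊗[R] K)).range by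
    obtain ⟨a, ha⟩ := h
    exact ⟨a, hφ (by rw [φ.commutes, ha, hy'])⟩
  clear hy hy'
  induction y with
  | zero => simp
  | add a b ha hb => rw [map_add]; exact add_mem ha hb
  | tmul a b =>
    obtain ⟨c, hc⟩ := IsIntegrallyClosed.isIntegral_iff.mp b.2
    refine ⟨c • a, ?_⟩
    change (c • a) ⊗ₜ (1 : K) = a ⊗ₜ (b : K)
    rw [TensorProduct.smul_tmul, ← hc, Algebra.algebraMap_eq_smul_one]

/-- An étale algebra over a domain is reduced. -/
lemma isReduced_of_etale (R S : Type*) [CommRing R] [IsDomain R]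
    [CommRing S] [Algebra R S] [Algebra.Etale R S] : IsReduced S := by
  have : IsReduced (FractionRing R ⊗[R] S) :=
    Algebra.FormallyUnramified.isReduced_of_field (FractionRing R) _
  exact isReduced_of_injective
    (Algebra.TensorProduct.includeRight : S →ₐ[R] FractionRing R ⊗[R] S)
    (Algebra.TensorProduct.includeRight_injective (IsFractionRing.injective R (FractionRing R)))

/-- Local-to-global device: applied to an annihilator and to an ideal of denominators, it allows
working on a basic open neighbourhood of each maximal ideal. -/
lemma eq_top_of_forall_isMaximal {S : Type*} [CommRing S] (I : Ideal S)
    (h : ∀ q : Ideal S, q.IsMaximal → ∃ f ∈ I, f ∉ q) : I = ⊤ := by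
  by_contra hI
  obtain ⟨q, hq, hIq⟩ := Ideal.exists_le_maximal I hI
  obtain ⟨f, hf, hfq⟩ := h q hq
  exact hfq (hIq hf)

/-- Smooth algebras over a field are reduced. -/
lemma isReduced_of_smooth_of_field (k S : Type*) [Field k] [CommRing S] [Algebra k S]
    [Algebra.Smooth k S] : IsReduced S := by
  refine ⟨fun z hz => ?_⟩
  suffices h : Module.annihilator S (Ideal.span {z}) = ⊤ by
    have h1 : (1 : S) ∈ Module.annihilator S (Ideal.span {z}) := h ▸ Submodule.mem_top
    simpa using congrArg Subtype.val
      (Module.mem_annihilator.mp h1 ⟨z, Ideal.mem_span_singleton_self z⟩)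
  refine eq_top_of_forall_isMaximal _ fun q hq => ?_
  obtain ⟨f, hfq, n, _, _, _⟩ :=
    Algebra.IsSmoothAt.exists_isStandardEtale_mvPolynomial (R := k) (p := q)
  have : IsReduced (Localization.Away f) := isReduced_of_etale (MvPolynomial (Fin n) k) _
  have hz0 : algebraMap S (Localization.Away f) z = 0 := (hz.map _).eq_zero
  obtain ⟨⟨_, m, rfl⟩, hm⟩ := (IsLocalization.map_eq_zero_iff (Submonoid.powers f) _ z).mp hz0
  refine ⟨f ^ m, Module.mem_annihilator.mpr ?_, fun h => hfq (hq.isPrime.mem_of_pow_mem m h)⟩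
  rintro ⟨a, ha⟩
  obtain ⟨b, rfl⟩ := Ideal.mem_span_singleton'.mp ha
  refine Subtype.ext ?_
  change f ^ m * (b * z) = 0
  rw [mul_left_comm, show f ^ m * z = 0 from hm, mul_zero]

/-- Smooth algebras over a field are integrally closed in their localizations at nonzerodivisors. -/
lemma exists_algebraMap_eq_of_isIntegral_of_smooth (k : Type*) {S L : Type*} [Field k]
    [CommRing S] [Algebra k S] [Algebra.Smooth k S] {s : S} (hs : s ∈ S⁰)
    [CommRing L] [Algebra S L] [IsLocalization.Away s L] {x : L} (hx : IsIntegral S x) :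
    ∃ y : S, algebraMap S L y = x := by
  -- The ideal of denominators of `x`. Near each maximal ideal `S` is étale over a polynomial ring,
  -- which is normal, so it contains an element outside that ideal.
  let I : Ideal S := (⊥ : Subalgebra S L).toSubmodule.comap (LinearMap.toSpanSingleton S L x)
  suffices h : I = ⊤ by
    have h1 : (1 : S) ∈ I := h ▸ Submodule.mem_top
    obtain ⟨y, hy⟩ := Algebra.mem_bot.mp (show (1 : S) • x ∈ (⊥ : Subalgebra S L) from h1)
    exact ⟨y, by rw [hy, one_smul]⟩
  refine eq_top_of_forall_isMaximal _ fun q hq => ?_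
  obtain ⟨f, hfq, n, _, _, _⟩ :=
    Algebra.IsSmoothAt.exists_isStandardEtale_mvPolynomial (R := k) (p := q)
  let Lf := Localization.Away (algebraMap S L f)
  let φ : Localization.Away f →+* Lf := Localization.awayMap (algebraMap S L) f
  algebraize [φ]
  have : IsScalarTower S (Localization.Away f) Lf := .of_algebraMap_eq fun a => by
    rw [RingHom.algebraMap_toAlgebra]
    simp only [φ, IsLocalization.Away.map, IsLocalization.map_eq]
    exact IsScalarTower.algebraMap_apply S L Lf a
  have hloc : IsLocalization.Away (algebraMap S (Localization.Away f) s) Lf :=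
    IsLocalization.Away.commutes (Localization.Away f) L Lf f s
  have hs' : algebraMap S (Localization.Away f) s ∈ (Localization.Away f)⁰ :=
    IsLocalization.map_nonZeroDivisors_le (Submonoid.powers f) _ ⟨s, hs, rfl⟩
  have hx' : IsIntegral (Localization.Away f) (algebraMap L Lf x) :=
    (hx.map (IsScalarTower.toAlgHom S L Lf)).tower_top
  obtain ⟨y, hy⟩ := exists_algebraMap_eq_of_isIntegral_of_etale (MvPolynomial (Fin n) k) hs' hx'
  obtain ⟨m, a, ha⟩ := IsLocalization.Away.surj f y
  have h1 : algebraMap L Lf (algebraMap S L f ^ m * x) = algebraMap L Lf (algebraMap S L a) := by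
    rw [← IsScalarTower.algebraMap_apply S L Lf,
      IsScalarTower.algebraMap_apply S (Localization.Away f) Lf, ← ha, map_mul, map_mul, hy, map_pow,
      map_pow, ← IsScalarTower.algebraMap_apply S L Lf,
      ← IsScalarTower.algebraMap_apply S (Localization.Away f) Lf, mul_comm]
  obtain ⟨⟨_, r, rfl⟩, hr⟩ := IsLocalization.exists_of_eq (M := Submonoid.powers (algebraMap S L f)) h1
  refine ⟨f ^ (r + m), ?_, fun h => hfq (hq.isPrime.mem_of_pow_mem _ h)⟩
  refine Algebra.mem_bot.mpr ⟨f ^ r * a, ?_⟩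
  change _ = f ^ (r + m) • x
  rw [Algebra.smul_def, map_mul, map_pow, map_pow, pow_add, mul_assoc]
  exact hr.symm

/-- A dense open subset of the spectrum of a reduced noetherian ring contains a basic open subset
defined by a nonzerodivisor. -/
lemma exists_mem_nonZeroDivisors_basicOpen_le {S : Type*} [CommRing S] [IsNoetherianRing S]
    [IsReduced S] (U : Opens (PrimeSpectrum S)) (hU : Dense (U : Set (PrimeSpectrum S))) :
    ∃ s ∈ S⁰, PrimeSpectrum.basicOpen s ≤ U := by
  let I := PrimeSpectrum.vanishingIdeal (U : Set (PrimeSpectrum S))ᶜ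
  have hI (y : S) : y ∈ I ↔ PrimeSpectrum.basicOpen y ≤ U := by
    rw [PrimeSpectrum.mem_vanishingIdeal]
    exact ⟨fun h p hp => by_contra fun hpU => hp (h p hpU), fun h p hp => by_contra fun h' => hp (h h')⟩
  by_contra! H
  -- Were `I` made of zerodivisors, some `x ≠ 0` would kill it. By reducedness `x` is nonzero at
  -- some point of the dense set `U`, where some element of `I` is nonzero too: a contradiction.
  have := Ideal.bot_lt_annihilator_of_disjoint_nonZeroDivisors (I := I)
    (Set.disjoint_left.mpr fun y hy hy' => H y hy' ((hI y).mp hy))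
  obtain ⟨x, hx, hx0⟩ := SetLike.exists_of_lt this
  have hne : (PrimeSpectrum.basicOpen x : Set (PrimeSpectrum S)).Nonempty := by
    rw [Set.nonempty_iff_ne_empty]
    intro h
    refine hx0 ?_
    have : PrimeSpectrum.basicOpen x = ⊥ := Opens.ext h
    exact (PrimeSpectrum.basicOpen_eq_bot_iff x |>.mp this).eq_zero
  obtain ⟨p, hpx, hpU⟩ := hU.inter_open_nonempty _ (PrimeSpectrum.basicOpen x).2 hne
  obtain ⟨_, ⟨y, rfl⟩, hpy, hyU⟩ :=
    PrimeSpectrum.isTopologicalBasis_basic_opens.exists_subset_of_mem_open hpU U.2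
  have h0 : x * y = 0 :=
    congrArg Subtype.val (Module.mem_annihilator.mp hx ⟨y, (hI y).mpr hyU⟩)
  have : x * y ∈ p.asIdeal := h0 ▸ p.asIdeal.zero_mem
  exact (p.2.mem_or_mem this).elim hpx hpy

end Normality

/-! ### Finiteness of integral closure over a perfect field -/

section Finiteness

open nonZeroDivisors

/-- By perfectness all constants are `p ^ e`-th powers, so over the image of Frobenius the ring is
generated by the variables, which are integral. -/
lemma finite_iterateFrobenius_mvPolynomial (k : Type*) [Field k] (p : ℕ) [ExpChar k p]
    [PerfectRing k p] (d e : ℕ) :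
    (iterateFrobenius (MvPolynomial (Fin d) k) p e).Finite := by
  have hq : 0 < p ^ e := pow_pos (expChar_pos k p) e
  set F := iterateFrobenius (MvPolynomial (Fin d) k) p e with hF
  have hint : F.IsIntegral := fun x => by
    refine ⟨Polynomial.X ^ (p ^ e) - Polynomial.C x, Polynomial.monic_X_pow_sub_C x hq.ne', ?_⟩
    simp [hF, iterateFrobenius_def]
  refine hint.to_finite (?_ : @Algebra.FiniteType _ _ _ _ F.toAlgebra)
  let : Algebra (MvPolynomial (Fin d) k) (MvPolynomial (Fin d) k) := F.toAlgebra
  refine ⟨(Set.finite_range (MvPolynomial.X : Fin d → MvPolynomial (Fin d) k)).toFinset, ?_⟩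
  rw [Set.Finite.coe_toFinset, _root_.eq_top_iff]
  rintro x -
  induction x using MvPolynomial.induction_on with
  | C a =>
    obtain ⟨b, rfl⟩ := (bijective_iterateFrobenius k p e).2 a
    have h := Subalgebra.algebraMap_mem (Algebra.adjoin (MvPolynomial (Fin d) k)
      (Set.range (MvPolynomial.X : Fin d → MvPolynomial (Fin d) k))) (MvPolynomial.C b)
    rwa [RingHom.algebraMap_toAlgebra, hF, iterateFrobenius_def, ← map_pow] at h
  | add a b ha hb => exact add_mem ha hb
  | mul_X a i ha => exact mul_mem ha (Algebra.subset_adjoin ⟨i, rfl⟩)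

lemma finite_of_comp_injective {P B D : Type*} [CommRing P] [IsNoetherianRing P] [CommRing B]
    [CommRing D] {f : P →+* B} {φ : B →+* D} (hφ : Function.Injective φ) (h : (φ.comp f).Finite) :
    f.Finite := by
  algebraize [f, φ.comp f]
  let φ' : B →ₗ[P] D :=
    { toFun := φ
      map_add' := map_add φ
      map_smul' := fun c x => map_mul φ (f c) x }
  exact Module.Finite.of_injective φ' hφ

/-- The integral closure of a finitely generated domain over a perfect field in its fraction field
is finite. -/
lemma finite_integralClosure_of_isDomain (k : Type*) {A K : Type*} [Field k] [PerfectField k]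
    [CommRing A] [IsDomain A] [Algebra k A] [Algebra.FiniteType k A] [Field K] [Algebra A K]
    [IsFractionRing A K] : Module.Finite A (integralClosure A K) := by
  obtain ⟨d, g, hg, hgf⟩ := exists_finite_inj_algHom_of_fg k A
  let P := MvPolynomial (Fin d) k
  let L := FractionRing P
  let : Algebra P A := g.toRingHom.toAlgebra
  have : Module.Finite P A := hgf
  have : FaithfulSMul P A := (faithfulSMul_iff_algebraMap_injective P A).mpr hg
  let : Algebra P K := ((algebraMap A K).comp (algebraMap P A)).toAlgebra
  have : IsScalarTower P A K := .of_algebraMap_eq' rfl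
  have : FaithfulSMul P K := (faithfulSMul_iff_algebraMap_injective P K).mpr
    ((IsFractionRing.injective A K).comp hg)
  let : Algebra L K := FractionRing.liftAlgebra P K
  have : FiniteDimensional L K := .of_isLocalization P A P⁰
  let p := ringExpChar k
  have : ExpChar k p := inferInstance
  have : ExpChar P p := expChar_of_injective_ringHom (MvPolynomial.C_injective _ k) p
  have : ExpChar L p := expChar_of_injective_ringHom (IsFractionRing.injective P L) p
  have : ExpChar K p := expChar_of_injective_ringHom (algebraMap L K).injective p
  -- In the separable extension `E / L` the integral closure is known to be finite; the purely
  -- inseparable rest is pushed into `E` by raising to the power `p ^ e`.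
  let E := separableClosure L K
  have : ExpChar E p := expChar_of_injective_ringHom (algebraMap L E).injective p
  let e := IsPurelyInseparable.exponent E K
  have : IsScalarTower P E K := .of_algebraMap_eq fun x => by
    rw [IsScalarTower.algebraMap_apply P L E]
    exact IsScalarTower.algebraMap_apply P L K x
  have he (a : K) : a ^ p ^ e ∈ E := by
    obtain ⟨b, hb⟩ := IsPurelyInseparable.exponent_def' E p a
    exact hb ▸ b.2
  let D := integralClosure P E
  have : Module.Finite P D := IsIntegralClosure.finite P L E D
  let φ : integralClosure P K →+* D :=
    (((iterateFrobenius K p e).codRestrict E he).comp (integralClosure P K).val.toRingHom).codRestrict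
      D.toSubring fun b => by
        have h : IsIntegral P (algebraMap E K
          ((iterateFrobenius K p e).codRestrict E he b)) := b.2.pow (p ^ e)
        exact (isIntegral_algHom_iff (IsScalarTower.toAlgHom P E K) (algebraMap E K).injective).mp h
  have hφ : Function.Injective φ := fun a b h => by
    have h1 : (a : K) ^ p ^ e = (b : K) ^ p ^ e := congrArg (fun x : D => ((x : E) : K)) h
    exact Subtype.ext (iterateFrobenius_inj K p e h1)
  -- `φ` is not `P`-linear but Frobenius-semilinear. This is harmless because `D` stays finite over
  -- `P` after composing with the finite Frobenius of `P`.
  have hcomm : φ.comp (algebraMap P (integralClosure P K)) =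
      (algebraMap P D).comp (iterateFrobenius P p e) := by
    refine RingHom.ext fun x => Subtype.ext (Subtype.ext ?_)
    change (algebraMap P K x) ^ p ^ e = algebraMap P K (iterateFrobenius P p e x)
    rw [iterateFrobenius_def, map_pow]
  have hfin : (φ.comp (algebraMap P (integralClosure P K))).Finite := by
    rw [hcomm]
    exact (RingHom.finite_algebraMap.mpr inferInstance).comp
      (finite_iterateFrobenius_mvPolynomial k p d e)
  have hB : Module.Finite P (integralClosure P K) :=
    RingHom.finite_algebraMap.mp (finite_of_comp_injective hφ hfin)
  have hBA : Module.Finite P (integralClosure A K) := by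
    let j : integralClosure A K →ₗ[P] integralClosure P K :=
      { toFun := fun x => ⟨x, isIntegral_trans (x : K) x.2⟩
        map_add' := fun _ _ => rfl
        map_smul' := fun c x => Subtype.ext <| by
          change ((c • x : integralClosure A K) : K) = c • (x : K)
          rfl }
    exact Module.Finite.of_injective j fun a b h =>
      Subtype.ext (congrArg (fun x : integralClosure P K => (x : K)) h)
  exact Module.Finite.of_restrictScalars_finite P A _

/-- If `s` is a nonzerodivisor of a reduced finitely generated algebra over a perfect field, then
any integral extension contained in the localization away from `s` is finite. -/
lemma finite_of_injective_away (k : Type*) {A B L : Type*} [Field k] [PerfectField k]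
    [CommRing A] [IsReduced A] [Algebra k A] [Algebra.FiniteType k A] {s : A} (hs : s ∈ A⁰)
    [CommRing L] [Algebra A L] [IsLocalization.Away s L] [CommRing B] [Algebra A B]
    [Algebra.IsIntegral A B] (i : B →ₐ[A] L) (hi : Function.Injective i) :
    Module.Finite A B := by
  have : IsNoetherianRing A := Algebra.FiniteType.isNoetherianRing k A
  have hfin : Finite (minimalPrimes A) := minimalPrimes.finite_of_isNoetherianRing A
  have hprime (q : minimalPrimes A) : q.1.IsPrime := q.2.1.1
  have hsq (q : minimalPrimes A) : s ∉ q.1 := fun h =>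
    (Set.disjoint_left.mp (Ideal.disjoint_nonZeroDivisors_of_mem_minimalPrimes q.2) h) hs
  let K (q : minimalPrimes A) := FractionRing (A ⧸ q.1)
  have hunit (q : minimalPrimes A) (y : Submonoid.powers s) :
      IsUnit (Algebra.ofId A (K q) y) := by
    obtain ⟨_, n, rfl⟩ := y
    rw [map_pow]
    refine IsUnit.pow n (IsUnit.mk0 _ ?_)
    change algebraMap A (K q) s ≠ 0
    rw [IsScalarTower.algebraMap_apply A (A ⧸ q.1) (K q), Ne,
      map_eq_zero_iff _ (IsFractionRing.injective (A ⧸ q.1) (K q))]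
    exact fun h => hsq q (Ideal.Quotient.eq_zero_iff_mem.mp h)
  let f (q : minimalPrimes A) : L →ₐ[A] K q :=
    IsLocalization.liftAlgHom (M := Submonoid.powers s) (hunit q)
  have hmod (q : minimalPrimes A) : Module.Finite A (integralClosure (A ⧸ q.1) (K q)) := by
    have : Algebra.FiniteType k (A ⧸ q.1) := inferInstance
    have := finite_integralClosure_of_isDomain k (A := A ⧸ q.1) (K := K q)
    exact Module.Finite.trans (A ⧸ q.1) _
  -- Reduction to domains, one component at a time: the nonzerodivisor `s` avoids each minimal
  -- prime, so `L` maps to every `K q`. Reducedness makes the joint map injective.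
  let Φ : B →ₗ[A] ∀ q : minimalPrimes A, integralClosure (A ⧸ q.1) (K q) :=
    LinearMap.pi fun q =>
      { toFun := fun b => ⟨f q (i b),
          ((Algebra.IsIntegral.isIntegral (R := A) b).map ((f q).comp i)).tower_top⟩
        map_add' := fun a b => Subtype.ext (by simp)
        map_smul' := fun c b => Subtype.ext (by simp) }
  refine Module.Finite.of_injective Φ ((injective_iff_map_eq_zero Φ).mpr fun b hb => ?_)
  have hb' (q : minimalPrimes A) : f q (i b) = 0 := congrArg Subtype.val (congrFun hb q)
  obtain ⟨n, a, ha⟩ := IsLocalization.Away.surj s (i b)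
  have ha0 : a = 0 := by
    have : a ∈ sInf (minimalPrimes A) := by
      refine Submodule.mem_sInf.mpr fun q hq => ?_
      have h1 : algebraMap A (K ⟨q, hq⟩) a = 0 := by
        rw [← (f ⟨q, hq⟩).commutes, ← ha, map_mul, hb', zero_mul]
      rw [IsScalarTower.algebraMap_apply A (A ⧸ q) (K ⟨q, hq⟩),
        map_eq_zero_iff _ (IsFractionRing.injective (A ⧸ q) (K ⟨q, hq⟩))] at h1
      exact Ideal.Quotient.eq_zero_iff_mem.mp h1
    rw [minimalPrimes, Ideal.sInf_minimalPrimes] at this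
    exact IsNilpotent.eq_zero (mem_nilradical.mp this)
  rw [ha0, map_zero] at ha
  exact (map_eq_zero_iff i hi).mp
    (((IsLocalization.Away.algebraMap_isUnit s).pow n |>.mul_left_eq_zero).mp (by simpa using ha))

end Finiteness

/-! ### From integral closedness to a local parameter to smoothness -/

section SmoothPoint

open nonZeroDivisors Polynomial

/-- A ring which is integrally closed in its localization at a nonzerodivisor `s` has a principal
maximal ideal locally at each maximal ideal which is minimal over `s`. -/
lemma exists_local_generator {B L : Type*} [CommRing B] [IsNoetherianRing B]
    (m : Ideal B) [m.IsMaximal] {s : B} (hsm : s ∈ m) (hs : s ∈ B⁰)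
    (hdim : ∀ q : Ideal B, q.IsPrime → s ∈ q → q ≤ m → q = m)
    [CommRing L] [Algebra B L] [IsLocalization.Away s L]
    (hint : ∀ x : L, IsIntegral B x → ∃ y, algebraMap B L y = x) :
    ∃ t ∈ m, ∃ u ∉ m, (∀ y ∈ m, ∃ c, u * y = t * c) ∧
      ∀ p ∈ minimalPrimes B, p ≤ m → t ∉ p := by
  have hreg {a b : B} (h : s * a = s * b) : a = b :=
    (mul_cancel_left_mem_nonZeroDivisors hs).mp h
  -- As `m` is minimal over `s`, it is an associated prime of the quotient by `s`; this yields `b`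
  -- with `m = (s : b)`.
  have hmin : m ∈ (Module.annihilator B (B ⧸ Ideal.span {s})).minimalPrimes := by
    rw [Ideal.annihilator_quotient]
    refine ⟨⟨inferInstance, (Ideal.span_singleton_le_iff_mem _).mpr hsm⟩, fun q hq hqm => ?_⟩
    exact (hdim q hq.1 ((Ideal.span_singleton_le_iff_mem _).mp hq.2) hqm).ge
  obtain ⟨-, b', hb'⟩ := isAssociatedPrime_iff.mp
    (AssociatedPrimes.mem_iff.mp
      (Module.associatedPrimes.minimalPrimes_annihilator_subset_associatedPrimes B (B ⧸ Ideal.span {s}) hmin))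
  obtain ⟨b, rfl⟩ := Ideal.Quotient.mk_surjective b'
  have hmem (y : B) : y ∈ m ↔ ∃ c, y * b = s * c := by
    rw [hb', Submodule.mem_colon_singleton, Submodule.mem_bot]
    change Ideal.Quotient.mk _ (y * b) = 0 ↔ _
    rw [Ideal.Quotient.eq_zero_iff_mem, Ideal.mem_span_singleton]
    rfl
  -- The fraction `b / s` carries `m` into `B`. Either it sends some `t ∈ m` outside `m`, and this
  -- `t` generates `m` locally, or it maps `m` into itself.
  by_cases H : ∃ t ∈ m, ∃ u ∉ m, t * b = s * u
  · obtain ⟨t, ht, u, hu, e⟩ := H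
    refine ⟨t, ht, u, hu, fun y hy => ?_, fun p hp hpm htp => ?_⟩
    · obtain ⟨c, hc⟩ := (hmem y).mp hy
      refine ⟨c, hreg ?_⟩
      linear_combination (-y) * e + t * hc
    · have hsu : s * u ∈ p := e ▸ p.mul_mem_right b htp
      rcases hp.1.1.mem_or_mem hsu with h | h
      · exact Set.disjoint_left.mp (Ideal.disjoint_nonZeroDivisors_of_mem_minimalPrimes hp) h hs
      · exact hu (hpm h)
  · push Not at H
    exfalso
    choose c hc using fun y : m => (hmem y).mp y.2
    have hcm (y : m) : c y ∈ m := by_contra fun h => H y y.2 (c y) h (hc y)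
    -- Multiplication by `b / s`. By Cayley–Hamilton on the finitely generated ideal `m`, which
    -- contains the nonzerodivisor `s`, the fraction is integral. So it lies in `B`, whence `s ∣ b`
    -- and `1 ∈ m`, absurd.
    let f : m →ₗ[B] m :=
      { toFun := fun y => ⟨c y, hcm y⟩
        map_add' := fun y z => Subtype.ext <| hreg <| by
          change s * c (y + z) = s * (c y + c z)
          rw [← hc, mul_add, ← hc, ← hc]
          exact add_mul (y : B) z b
        map_smul' := fun a y => Subtype.ext <| hreg <| by
          change s * c (a • y) = s * (a * c y)
          rw [← hc, mul_left_comm, ← hc]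
          exact mul_assoc a (y : B) b }
    obtain ⟨P, hP, hP0⟩ := LinearMap.exists_monic_and_aeval_eq_zero B f
    have hunit : IsUnit (algebraMap B L s) := IsLocalization.Away.algebraMap_isUnit s
    let x : L := algebraMap B L b * hunit.unit⁻¹
    have hx : x * algebraMap B L s = algebraMap B L b := by
      rw [mul_assoc, IsUnit.val_inv_mul, mul_one]
    have hf (y : m) : algebraMap B L (f y : B) = x * algebraMap B L y := by
      refine hunit.mul_left_cancel ?_
      rw [← map_mul, show s * (f y : B) = y * b from (hc y).symm, map_mul, ← hx]
      ring
    have haeval (Q : B[X]) (y : m) : algebraMap B L (aeval f Q y : m) = aeval x Q * algebraMap B L y := by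
      induction Q using Polynomial.induction_on' with
      | add p q hp hq => simp [hp, hq, add_mul]
      | monomial n a =>
        rw [aeval_monomial, aeval_monomial, mul_assoc, ← Algebra.smul_def, ← Algebra.smul_def]
        change algebraMap B L (a * ((f ^ n) y : m)) = _
        rw [map_mul, Algebra.smul_def]
        congr 1
        induction n with
        | zero => simp
        | succ n ih =>
          rw [pow_succ', Module.End.mul_apply, hf, ih]
          ring
    have hxint : IsIntegral B x := ⟨P, hP, by
      have := haeval P ⟨s, hsm⟩
      rw [hP0] at this
      rw [← aeval_def]
      exact hunit.mul_left_eq_zero.mp (by simpa using this.symm)⟩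
    obtain ⟨y, hy⟩ := hint x hxint
    have hb : s * y = b := by
      refine IsLocalization.injective L (Submonoid.powers_le.mpr hs) ?_
      rw [map_mul, hy, mul_comm, hx]
    exact (Ideal.ne_top_iff_one m).mp (Ideal.IsPrime.ne_top inferInstance)
      ((hmem 1).mpr ⟨y, by rw [hb, one_mul]⟩)

/-- A prime contains a finite product of ideals only if it contains one of them. Inverting `w`
removes the components that do not pass through `m`. -/
lemma exists_mem_minimalPrimes_of_not_le {B : Type*} [CommRing B] [IsNoetherianRing B]
    (m : Ideal B) [m.IsPrime] :
    ∃ w ∉ m, ∀ p ∈ minimalPrimes B, ¬ p ≤ m → w ∈ p := by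
  classical
  let W := (minimalPrimes.finite_of_isNoetherianRing B).toFinset.filter (fun p => ¬ p ≤ m)
  have h : ¬ ∏ p ∈ W, p ≤ m := fun h => by
    obtain ⟨p, hp, hpm⟩ := (Ideal.IsPrime.prod_le inferInstance).mp h
    exact (Finset.mem_filter.mp hp).2 hpm
  obtain ⟨w, hw, hwm⟩ := SetLike.not_le_iff_exists.mp h
  refine ⟨w, hwm, fun p hp hpm => ?_⟩
  exact (Ideal.prod_le_inf.trans (Finset.inf_le (f := id) (b := p) (Finset.mem_filter.mpr ⟨by simpa using hp, hpm⟩))) hw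

/-- A reduced algebra of finite type over an algebraically closed field is smooth at a maximal ideal
which is locally principal, generated by a nonzerodivisor. -/
lemma isSmoothAt_of_local_generator (k : Type*) {B : Type*} [Field k] [IsAlgClosed k]
    [CommRing B] [IsReduced B] [Algebra k B] [Algebra.FiniteType k B] (m : Ideal B) [m.IsMaximal]
    {t u : B} (ht : t ∈ m) (hu : u ∉ m) (htu : ∀ y ∈ m, ∃ c, u * y = t * c)
    (htp : ∀ p ∈ minimalPrimes B, p ≤ m → t ∉ p) : Algebra.IsSmoothAt k m := by
  have : IsNoetherianRing B := Algebra.FiniteType.isNoetherianRing k B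
  obtain ⟨w, hwm, hw⟩ := exists_mem_minimalPrimes_of_not_le m
  let C := Localization.Away w
  -- The parameter `t` as a map to the affine line. It is flat since `C` is torsion-free over
  -- `k[X]`, and unramified at the point since `t` generates the maximal ideal and the residue
  -- extension is separable; hence étale there.
  let φ : k[X] →ₐ[k] C := aeval (algebraMap B C t)
  let : Algebra k[X] C := φ.toAlgebra
  have : IsScalarTower k k[X] C := .of_algebraMap_eq' φ.comp_algebraMap.symm
  have hX : algebraMap k[X] C X = algebraMap B C t := aeval_X _
  have : Algebra.FiniteType k C := Algebra.FiniteType.trans (S := B) inferInstance inferInstance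
  have : Algebra.FiniteType k[X] C := .of_restrictScalars_finiteType k _ _
  have : Algebra.FinitePresentation k[X] C := Algebra.FinitePresentation.of_finiteType.mp inferInstance
  have hmem (P : k[X]) (hP : P ≠ 0) (p : Ideal B) (hp : p ∈ minimalPrimes B) (hpm : p ≤ m) :
      aeval t P ∉ p := by
    have hprime := hp.1.1
    -- Write `P = X ^ r * Q` with `Q(0) ≠ 0`: the prime `p` avoids `t`, and `Q(t)` is congruent to
    -- the unit `Q(0)` modulo `m`.
    obtain ⟨Q, hQ, hQ0⟩ := exists_eq_pow_rootMultiplicity_mul_and_not_dvd P hP 0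
    rw [hQ, map_mul, map_pow, map_zero, sub_zero, aeval_X]
    intro h
    rcases hprime.mem_or_mem h with h | h
    · exact htp p hp hpm (hprime.mem_of_pow_mem _ h)
    · rw [C_0, sub_zero, X_dvd_iff] at hQ0
      have h1 : aeval t Q ∈ m := hpm h
      rw [← Polynomial.divX_mul_X_add Q, map_add, map_mul, aeval_X, aeval_C] at h1
      have h2 := (Ideal.add_mem_iff_right _ (m.mul_mem_left _ ht)).mp h1
      exact Ideal.IsPrime.ne_top (I := m) inferInstance (Ideal.eq_top_of_isUnit_mem _ h2
        ((IsUnit.mk0 _ hQ0).map (algebraMap k B)))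
  have hww (n : ℕ) : w ^ n ∉ m := fun h => hwm (Ideal.IsPrime.mem_of_pow_mem inferInstance _ h)
  have : Module.IsTorsionFree k[X] C := by
    refine .of_smul_eq_zero fun P z hz => or_iff_not_imp_left.mpr fun hP => ?_
    obtain ⟨n, a, ha⟩ := IsLocalization.Away.surj w z
    have h1 : algebraMap B C (aeval t P * a) = 0 := by
      have h2 : algebraMap B C (aeval t P) = algebraMap k[X] C P :=
        (aeval_algebraMap_apply C t P).symm
      rw [map_mul, ← ha, h2, ← mul_assoc, ← Algebra.smul_def, hz, zero_mul]
    obtain ⟨⟨_, r, rfl⟩, hr⟩ := (IsLocalization.map_eq_zero_iff (Submonoid.powers w) C _).mp h1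
    have hwa : w * a = 0 := by
      refine IsNilpotent.eq_zero (mem_nilradical.mp ?_)
      rw [nilradical, ← Ideal.sInf_minimalPrimes]
      refine Submodule.mem_sInf.mpr fun p hp => ?_
      have hprime := hp.1.1
      by_cases hpm : p ≤ m
      · have h3 : w ^ r * (aeval t P * a) ∈ p := hr ▸ p.zero_mem
        refine Ideal.mul_mem_left p _ ?_
        exact (hprime.mem_or_mem ((hprime.mem_or_mem h3).resolve_left
          fun h => hww r (hpm h))).resolve_left (hmem P hP p hp hpm)
      · exact Ideal.mul_mem_right _ p (hw p hp hpm)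
    have hunit : IsUnit (algebraMap B C w) := IsLocalization.Away.algebraMap_isUnit w
    have h4 : algebraMap B C a = 0 :=
      hunit.mul_right_eq_zero.mp (by rw [← map_mul, hwa, map_zero])
    rw [h4] at ha
    exact (hunit.pow n).mul_left_eq_zero.mp (by simpa using ha)
  obtain ⟨q, hq, hmq⟩ := Ideal.exists_le_maximal (m.map (algebraMap B C)) (by
    rw [IsLocalization.map_algebraMap_ne_top_iff_disjoint (Submonoid.powers w), Set.disjoint_left]
    rintro _ ⟨n, rfl⟩ h
    exact hww n h)
  have hqm : m = q.comap (algebraMap B C) :=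
    Ideal.IsMaximal.eq_of_le inferInstance (Ideal.IsPrime.ne_top inferInstance)
      (Ideal.map_le_iff_le_comap.mp hmq)
  have hsep : Algebra.IsSeparable k q.ResidueField := by
    have : Module.Finite k (C ⧸ q) := by
      let : Field (C ⧸ q) := Ideal.Quotient.field q
      exact finite_of_finite_type_of_isJacobsonRing k (C ⧸ q)
    have : Module.Finite k q.ResidueField := Module.Finite.of_surjective
      (IsScalarTower.toAlgHom k (C ⧸ q) q.ResidueField).toLinearMap
      q.bijective_algebraMap_quotient_residueField.2
    infer_instance
  let p := q.under k[X]
  have hloc : IsLocalization.AtPrime (Localization.AtPrime q) m := by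
    subst hqm
    exact IsLocalization.isLocalization_isLocalization_atPrime_isLocalization (Submonoid.powers w) _ q
  let := Localization.AtPrime.algebraOfLiesOver p q
  have : Algebra.IsUnramifiedAt k[X] q := by
    refine (Algebra.isUnramifiedAt_iff_map_eq k[X] p q).mpr ⟨?_, le_antisymm ?_ ?_⟩
    · exact Algebra.isSeparable_tower_top_of_isSeparable k p.ResidueField q.ResidueField
    · rw [IsScalarTower.algebraMap_eq k[X] C, ← Ideal.map_map,
        ← Localization.AtPrime.map_eq_maximalIdeal]
      exact Ideal.map_mono (Ideal.map_le_iff_le_comap.mpr le_rfl)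
    · rw [← IsLocalization.AtPrime.map_eq_maximalIdeal m, Ideal.map_le_iff_le_comap]
      intro y hy
      obtain ⟨c, hc⟩ := htu y hy
      have hunit : IsUnit (algebraMap B (Localization.AtPrime q) u) :=
        IsLocalization.map_units (M := m.primeCompl) _ ⟨u, hu⟩
      rw [Ideal.mem_comap, ← Ideal.unit_mul_mem_iff_mem _ hunit, ← map_mul, hc, map_mul]
      refine Ideal.mul_mem_right _ _ ?_
      have hXp : (X : k[X]) ∈ p := by
        rw [Ideal.mem_comap, hX]
        exact hmq (Ideal.mem_map_of_mem _ ht)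
      have := Ideal.mem_map_of_mem (algebraMap k[X] (Localization.AtPrime q)) hXp
      rwa [IsScalarTower.algebraMap_apply k[X] C, hX, ← IsScalarTower.algebraMap_apply] at this
  have := Algebra.IsEtaleAt.of_isUnramifiedAt_of_flat (R := k[X]) q
  have : Algebra.FormallySmooth k (Localization.AtPrime q) := .comp k k[X] _
  let e : Localization.AtPrime m ≃ₐ[B] Localization.AtPrime q :=
    IsLocalization.algEquiv m.primeCompl _ _
  exact .of_equiv (e.symm.restrictScalars k)

end SmoothPoint

/-! ### Pure dimension one in terms of specializations -/

section Dimension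

lemma krullDim_eq_one_iff {Y : Type*} [PartialOrder Y] :
    Order.krullDim Y = 1 ↔ (∀ x : Y, IsMin x ∨ IsMax x) ∧ ∃ x y : Y, x < y :=
  ⟨fun h => ⟨Order.krullDim_le_one_iff.mp h.le, Order.one_le_krullDim_iff.mp h.ge⟩,
    fun h => by
      have h1 : Order.krullDim Y ≤ 1 := Order.krullDim_le_one_iff.mpr h.1
      have h2 : 1 ≤ Order.krullDim Y := Order.one_le_krullDim_iff.mpr h.2
      exact le_antisymm h1 h2⟩

section

attribute [local instance] specializationOrder

/-- Irreducible closed sets of a sober space have unique generic points, so chains of them are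
chains of specializations. -/
lemma topologicalKrullDim_eq_one_iff {Y : Type*} [TopologicalSpace Y] [QuasiSober Y]
    [T0Space Y] : topologicalKrullDim Y = 1 ↔
      (∀ x y z : Y, x ⤳ y → y ⤳ z → x = y ∨ y = z) ∧ ∃ x y : Y, x ⤳ y ∧ x ≠ y := by
  rw [show topologicalKrullDim Y = Order.krullDim Y from
    Order.krullDim_eq_of_orderIso irreducibleSetEquivPoints]
  refine krullDim_eq_one_iff.trans ?_
  refine and_congr ⟨fun h x y z hxy hyz => ?_, fun h y => ?_⟩ ⟨?_, ?_⟩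
  · rcases h y with h | h
    · exact .inr (le_antisymm (h (show z ≤ y from hyz)) hyz)
    · exact .inl (le_antisymm (h (show y ≤ x from hxy)) hxy)
  · by_contra! H
    obtain ⟨h1, h2⟩ := H
    rw [not_isMin_iff] at h1
    rw [not_isMax_iff] at h2
    obtain ⟨z, hz⟩ := h1
    obtain ⟨x, hx⟩ := h2
    rcases h x y z hx.le hz.le with e | e
    · exact hx.ne' e
    · exact hz.ne' e
  · rintro ⟨a, b, hab⟩
    exact ⟨b, a, hab.le, hab.ne'⟩
  · rintro ⟨x, y, hxy, hne⟩
    exact ⟨y, x, lt_of_le_of_ne (show y ≤ x from hxy) hne.symm⟩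

end

lemma topologicalKrullDim_coe_eq_one_iff {X : Type*} [TopologicalSpace X] [QuasiSober X]
    [T0Space X] (Z : Set X) (hZ : IsClosed Z) : topologicalKrullDim Z = 1 ↔
      (∀ x ∈ Z, ∀ y ∈ Z, ∀ z ∈ Z, x ⤳ y → y ⤳ z → x = y ∨ y = z) ∧
        ∃ x ∈ Z, ∃ y ∈ Z, x ⤳ y ∧ x ≠ y := by
  have : QuasiSober Z := hZ.isClosedEmbedding_subtypeVal.quasiSober
  simp only [topologicalKrullDim_eq_one_iff, subtype_specializes_iff, Subtype.forall,
    Subtype.exists, ne_eq, Subtype.mk.injEq, exists_prop]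

/-- A pointwise description of sober spaces of pure dimension one. -/
lemma pureOneDimensional_iff {X : Type*} [TopologicalSpace X] [QuasiSober X] [T0Space X] :
    PureOneDimensional X ↔ (∀ x y z : X, x ⤳ y → y ⤳ z → x = y ∨ y = z) ∧
      ∀ x : X, (∀ y, y ⤳ x → y = x) → ∃ z, x ⤳ z ∧ z ≠ x := by
  refine ⟨fun h => ⟨fun x y z hxy hyz => ?_, fun x hx => ?_⟩, fun ⟨h1, h2⟩ Z hZ => ?_⟩
  · obtain ⟨Z, hZ, hxZ⟩ := exists_mem_irreducibleComponents_subset_of_isIrreducible _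
      (isIrreducible_singleton (x := x)).closure
    have hmem {w : X} (hw : x ⤳ w) : w ∈ Z := hxZ hw.mem_closure
    exact ((topologicalKrullDim_coe_eq_one_iff Z (isClosed_of_mem_irreducibleComponents Z hZ)).mp
      (h Z hZ)).1 x (hmem specializes_rfl) y (hmem hxy) z (hmem (hxy.trans hyz)) hxy hyz
  · have hZ : closure {x} ∈ irreducibleComponents X := by
      refine ⟨isIrreducible_singleton.closure, fun W hW hxW => ?_⟩
      obtain ⟨η, hη⟩ := QuasiSober.sober hW.closure isClosed_closure
      have : η = x := hx η (hη.specializes (subset_closure (hxW (subset_closure rfl))))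
      rw [← this, hη.def]
      exact subset_closure
    obtain ⟨-, a, ha, b, hb, hab, hne⟩ :=
      (topologicalKrullDim_coe_eq_one_iff _ isClosed_closure).mp (h _ hZ)
    rw [← specializes_iff_mem_closure] at ha hb
    exact ⟨b, hb, fun e => hne ((hx a (e ▸ hab)).trans e.symm)⟩
  · have hcl := isClosed_of_mem_irreducibleComponents Z hZ
    obtain ⟨η, hη⟩ := QuasiSober.sober hZ.1 hcl
    refine (topologicalKrullDim_coe_eq_one_iff Z hcl).mpr
      ⟨fun x _ y _ z _ => h1 x y z, η, hη.mem, ?_⟩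
    obtain ⟨z, hz, hne⟩ := h2 η fun y hy => by
      have : closure {y} ⊆ Z := hZ.2 (isIrreducible_singleton.closure) (by
        rw [← hη.def]
        exact closure_minimal (Set.singleton_subset_iff.mpr hy.mem_closure) isClosed_closure)
      exact (hη.specializes (this (subset_closure rfl))).antisymm hy |>.eq.symm
    exact ⟨z, hη.specializes_iff_mem.mp hz, hz, hne.symm⟩

lemma exists_specializes_minimal {X : Type*} [TopologicalSpace X] [QuasiSober X] [T0Space X]
    (x : X) : ∃ η, η ⤳ x ∧ ∀ y, y ⤳ η → y = η := by
  obtain ⟨Z, hZ, hxZ⟩ := exists_mem_irreducibleComponents_subset_of_isIrreducible _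
    (isIrreducible_singleton (x := x))
  obtain ⟨η, hη⟩ := QuasiSober.sober hZ.1 (isClosed_of_mem_irreducibleComponents Z hZ)
  refine ⟨η, hη.specializes (hxZ rfl), fun y hy => ?_⟩
  have : closure {y} ⊆ Z := hZ.2 (isIrreducible_singleton.closure) (by
    rw [← hη.def]
    exact closure_minimal (Set.singleton_subset_iff.mpr hy.mem_closure) isClosed_closure)
  exact (hη.specializes (this (subset_closure rfl))).antisymm hy |>.eq.symm

lemma dense_of_forall_minimal {X : Type*} [TopologicalSpace X] [QuasiSober X] [T0Space X]
    {U : Set X} (h : ∀ η : X, (∀ y, y ⤳ η → y = η) → η ∈ U) : Dense U := fun x => by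
  obtain ⟨η, hη, hmin⟩ := exists_specializes_minimal x
  exact closure_minimal (Set.singleton_subset_iff.mpr (subset_closure (h η hmin))) isClosed_closure
    hη.mem_closure

lemma PureOneDimensional.eq_or_eq {X : Type*} [TopologicalSpace X] [QuasiSober X] [T0Space X]
    (h : PureOneDimensional X) {x y z : X} (hxy : x ⤳ y) (hyz : y ⤳ z) : x = y ∨ y = z :=
  (pureOneDimensional_iff.mp h).1 x y z hxy hyz

lemma PureOneDimensional.not_isClosed_singleton {X : Type*} [TopologicalSpace X] [QuasiSober X]
    [T0Space X] (h : PureOneDimensional X) {x : X} (hx : ∀ y, y ⤳ x → y = x) :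
    ¬ IsClosed {x} := fun hc => by
  obtain ⟨z, hz, hne⟩ := (pureOneDimensional_iff.mp h).2 x hx
  exact hne (hz.mem_closed hc rfl)

lemma isClosed_singleton_of_forall_specializes {X : Type*} [TopologicalSpace X] {x : X}
    (h : ∀ y, x ⤳ y → y = x) : IsClosed {x} := by
  rw [← closure_subset_iff_isClosed]
  exact fun y hy => h y (specializes_iff_mem_closure.mpr hy)

/-- In a space of pure dimension one, a subset is dense as soon as its complement consists of
closed points. -/
lemma PureOneDimensional.dense {X : Type*} [TopologicalSpace X] [QuasiSober X] [T0Space X]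
    (h : PureOneDimensional X) {U : Set X} (hc : ∀ x ∉ U, IsClosed {x}) : Dense U :=
  dense_of_forall_minimal fun η hη => by
    by_contra hηU
    exact h.not_isClosed_singleton hη (hc η hηU)

/-- A component of a Noetherian space contains a nonempty open set, which `U` meets; open sets are
stable under generization. -/
lemma mem_of_dense_of_minimal {X : Type*} [TopologicalSpace X] [QuasiSober X] [T0Space X]
    [NoetherianSpace X] {U : Set X} (hU : IsOpen U) (hd : Dense U) {η : X}
    (hη : ∀ y, y ⤳ η → y = η) : η ∈ U := by
  have hZ : closure {η} ∈ irreducibleComponents X := by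
    refine ⟨isIrreducible_singleton.closure, fun W hW hxW => ?_⟩
    obtain ⟨ξ, hξ⟩ := QuasiSober.sober hW.closure isClosed_closure
    have : ξ = η := hη ξ (hξ.specializes (subset_closure (hxW (subset_closure rfl))))
    rw [← this, hξ.def]
    exact subset_closure
  obtain ⟨V, hV, hVne, hVle⟩ :=
    NoetherianSpace.exists_isOpen_nonempty_subset_irreducibleComponent _ hZ
  obtain ⟨x, hxV, hxU⟩ := hd.inter_open_nonempty V hV hVne
  exact (specializes_iff_mem_closure.mpr (hVle hxV)).mem_open hU hxU

/-- In a Noetherian space of pure dimension one, the complement of a dense open subset consists of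
closed points. -/
lemma PureOneDimensional.isClosed_singleton {X : Type*} [TopologicalSpace X] [QuasiSober X]
    [T0Space X] [NoetherianSpace X] (h : PureOneDimensional X) {U : Set X} (hU : IsOpen U)
    (hd : Dense U) {x : X} (hx : x ∉ U) : IsClosed {x} := by
  refine isClosed_singleton_of_forall_specializes fun y hy => ?_
  obtain ⟨η, hη, hmin⟩ := exists_specializes_minimal x
  rcases h.eq_or_eq hη hy with e | e
  · exact (hx (e ▸ mem_of_dense_of_minimal hU hd hmin)).elim
  · exact e.symm

/-- A closed subset of a Noetherian space, all of whose points are closed, is finite. -/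
lemma finite_of_forall_isClosed_singleton {X : Type*} [TopologicalSpace X] [QuasiSober X]
    [T0Space X] [NoetherianSpace X] {Z : Set X} (hZ : IsClosed Z)
    (h : ∀ x ∈ Z, IsClosed {x}) : Z.Finite := by
  obtain ⟨S, hS, hcl, hirr, hZS⟩ := NoetherianSpace.exists_finite_set_isClosed_irreducible hZ
  rw [hZS]
  refine hS.sUnion fun t ht => ?_
  obtain ⟨η, hη⟩ := QuasiSober.sober (hirr t ht) (hcl t ht)
  have hηZ : η ∈ Z := hZS ▸ Set.mem_sUnion_of_mem hη.mem ht
  rw [← hη.def, (h η hηZ).closure_eq]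
  exact Set.finite_singleton η

/-- Transport of purity along a closed map with discrete fibres that is injective over a
dense open subset. -/
lemma PureOneDimensional.of_isClosedMap {X Y : Type*} [TopologicalSpace X] [QuasiSober X]
    [T0Space X] [TopologicalSpace Y] [QuasiSober Y] [T0Space Y] [NoetherianSpace X]
    (h : PureOneDimensional Y) (f : X → Y) (hf : Continuous f) (hcl : IsClosedMap f)
    (hinc : ∀ x y, x ⤳ y → f x = f y → x = y) {U : Set Y} (hU : IsOpen U)
    (hdX : Dense (f ⁻¹' U))
    (hopen : ∀ x ∈ f ⁻¹' U, ∀ y, y ⤳ f x → ∃ x', x' ⤳ x ∧ f x' = y) :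
    PureOneDimensional X := by
  refine pureOneDimensional_iff.mpr ⟨fun x y z hxy hyz => ?_, fun x hx => ?_⟩
  · exact (h.eq_or_eq (hxy.map hf) (hyz.map hf)).imp (hinc _ _ hxy) (hinc _ _ hyz)
  -- A generic point lies over `U`, where generizations lift, so its image is generic. A proper
  -- specialization of the image lifts because `f` is closed.
  · have hxU := mem_of_dense_of_minimal (hU.preimage hf) hdX hx
    obtain ⟨w, hw, hne⟩ := (pureOneDimensional_iff.mp h).2 (f x) fun y hy => by
      obtain ⟨x', hx', rfl⟩ := hopen x hxU y hy
      rw [hx x' hx']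
    have : w ∈ f '' closure {x} := by
      have h1 : f x ∈ f '' closure {x} := ⟨x, subset_closure rfl, rfl⟩
      exact hw.mem_closed (hcl _ isClosed_closure) h1
    obtain ⟨z, hz, rfl⟩ := this
    exact ⟨z, specializes_iff_mem_closure.mpr hz, fun e => hne (e ▸ rfl)⟩

end Dimension

/-! ### Extension of integral functions on smooth schemes -/

section Extension

lemma dense_basicOpen_of_mem_nonZeroDivisors {S : Type*} [CommRing S] {s : S}
    (hs : s ∈ nonZeroDivisors S) : Dense (PrimeSpectrum.basicOpen s : Set (PrimeSpectrum S)) := by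
  intro p
  obtain ⟨q, hq, hqp⟩ := Ideal.exists_minimalPrimes_le (I := ⊥) (J := p.asIdeal) bot_le
  have hqs : (⟨q, hq.1.1⟩ : PrimeSpectrum S) ∈ PrimeSpectrum.basicOpen s := fun h =>
    Set.disjoint_left.mp (Ideal.disjoint_nonZeroDivisors_of_mem_minimalPrimes hq) h hs
  exact closure_mono (Set.singleton_subset_iff.mpr hqs)
    ((PrimeSpectrum.le_iff_specializes ⟨q, hq.1.1⟩ p).mp hqp).mem_closure

lemma map_map_apply {X : Scheme.{u}} {U V W : X.Opens} (h : U ≤ V) (h' : V ≤ W) (x : Γ(X, W)) :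
    X.presheaf.map (homOfLE h).op (X.presheaf.map (homOfLE h').op x) =
      X.presheaf.map (homOfLE (h.trans h')).op x :=
  (ConcreteCategory.congr_hom (X.presheaf.map_comp (homOfLE h').op (homOfLE h).op) x).symm

/-- On a reduced scheme a nonzero function is nonvanishing on some nonempty open set, which meets
`U`. -/
lemma map_injective_of_subset_closure {X : Scheme.{u}} [IsReduced X] {U V : X.Opens} (h : U ≤ V)
    (hd : (V : Set X) ⊆ closure U) :
    Function.Injective (X.presheaf.map (homOfLE h).op) := by
  refine (injective_iff_map_eq_zero (X.presheaf.map (homOfLE h).op).hom).mpr fun x hx => ?_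
  rw [← basicOpen_eq_bot_iff]
  by_contra hne
  obtain ⟨y, hy⟩ := (Opens.ne_bot_iff_nonempty _).mp hne
  obtain ⟨z, hz, hzU⟩ := mem_closure_iff.mp (hd (X.basicOpen_le x hy)) _ (X.basicOpen x).2 hy
  have := X.basicOpen_res x (homOfLE h).op
  have h0 : X.basicOpen ((X.presheaf.map (homOfLE h).op) x) = ⊥ := by
    rw [show (X.presheaf.map (homOfLE h).op) x = 0 from hx, Scheme.basicOpen_zero]
  have hzz : z ∈ U ⊓ X.basicOpen x := ⟨hzU, hz⟩
  rw [← this, h0] at hzz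
  exact hzz

lemma subset_closure_basicOpen {X : Scheme.{u}} {V : X.Opens} (hV : IsAffineOpen V) {s : Γ(X, V)}
    (hs : s ∈ nonZeroDivisors Γ(X, V)) : (V : Set X) ⊆ closure (X.basicOpen s) := fun y hy => by
  obtain ⟨p, rfl⟩ := hV.range_fromSpec.ge hy
  have := image_closure_subset_closure_image hV.fromSpec.continuous
    ⟨p, dense_basicOpen_of_mem_nonZeroDivisors hs p, rfl⟩
  rwa [← hV.fromSpec_image_basicOpen]

lemma exists_mem_nonZeroDivisors_basicOpen_le_of_isAffineOpen {X : Scheme.{u}} {V W : X.Opens}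
    (hV : IsAffineOpen V) [IsNoetherianRing Γ(X, V)] [_root_.IsReduced Γ(X, V)]
    (hd : (V : Set X) ⊆ closure W) : ∃ s ∈ nonZeroDivisors Γ(X, V), X.basicOpen s ≤ W := by
  obtain ⟨s, hs, hsW⟩ := exists_mem_nonZeroDivisors_basicOpen_le (hV.fromSpec ⁻¹ᵁ W) (by
    intro p
    have : p ∈ hV.fromSpec ⁻¹' closure W := hd (hV.range_fromSpec.le ⟨p, rfl⟩)
    rwa [hV.fromSpec.isOpenEmbedding.isOpenMap.preimage_closure_eq_closure_preimage
      hV.fromSpec.continuous] at this)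
  refine ⟨s, hs, ?_⟩
  rw [← hV.fromSpec_image_basicOpen]
  exact (hV.fromSpec.image_mono hsW).trans (hV.fromSpec.image_preimage_le W)

variable {k : Type u} [Field k]

lemma scalars_eq {X : Scheme.{u}} (π : X ⟶ Spec (.of k)) (U : X.Opens) :
    scalars π U = (π.appLE ⊤ U le_top).hom.comp (Scheme.ΓSpecIso (.of k)).inv.hom := by
  simp [scalars, Scheme.Hom.appLE]
  rfl

lemma smooth_scalars {X : Scheme.{u}} (π : X ⟶ Spec (.of k)) [Smooth π] {U : X.Opens}
    (hU : IsAffineOpen U) : (scalars π U).Smooth := by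
  rw [scalars_eq]
  exact RingHom.Smooth.comp (RingHom.Smooth.of_bijective
    (ConcreteCategory.bijective_of_isIso (Scheme.ΓSpecIso (.of k)).inv))
    (π.smooth_appLE (isAffineOpen_top _) hU le_top)

lemma finiteType_scalars {X : Scheme.{u}} (π : X ⟶ Spec (.of k)) [LocallyOfFiniteType π]
    {U : X.Opens} (hU : IsAffineOpen U) : (scalars π U).FiniteType := by
  rw [scalars_eq]
  exact RingHom.FiniteType.comp (π.finiteType_appLE (isAffineOpen_top _) hU le_top)
    (RingHom.FiniteType.of_surjective _
    (ConcreteCategory.bijective_of_isIso (Scheme.ΓSpecIso (.of k)).inv).2)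

lemma isReduced_of_smooth {X : Scheme.{u}} (π : X ⟶ Spec (.of k)) [Smooth π] : IsReduced X := by
  have hred (U : X.affineOpens) : _root_.IsReduced Γ(X, U) := by
    let := (scalars π U.1).toAlgebra
    have : Algebra.Smooth k Γ(X, U) := smooth_scalars π U.2
    exact isReduced_of_smooth_of_field k _
  have (x : X) : _root_.IsReduced (X.presheaf.stalk x) := by
    obtain ⟨U, hU, hxU, -⟩ := exists_isAffineOpen_mem_and_subset (x := x) (U := ⊤) trivial
    let := TopCat.Presheaf.algebra_section_stalk X.presheaf ⟨x, hxU⟩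
    have := hU.isLocalization_stalk ⟨x, hxU⟩
    have : _root_.IsReduced Γ(X, U) := hred ⟨U, hU⟩
    exact isReduced_localizationPreserves (hU.primeIdealOf ⟨x, hxU⟩).asIdeal.primeCompl
      (X.presheaf.stalk x) this
  exact isReduced_of_isReduced_stalk X

lemma exists_map_eq_of_isIntegralElem_of_isAffineOpen {Y : Scheme.{u}} (π : Y ⟶ Spec (.of k))
    [Smooth π] {V : Y.Opens} (hV : IsAffineOpen V) {W : Y.Opens} (h : W ≤ V)
    (hd : (V : Set Y) ⊆ closure W) (x : Γ(Y, W))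
    (hx : (Y.presheaf.map (homOfLE h).op).hom.IsIntegralElem x) :
    ∃ y, Y.presheaf.map (homOfLE h).op y = x := by
  let := (scalars π V).toAlgebra
  have : Algebra.Smooth k Γ(Y, V) := smooth_scalars π hV
  have : _root_.IsReduced Γ(Y, V) := isReduced_of_smooth_of_field k _
  have : IsNoetherianRing Γ(Y, V) := Algebra.FiniteType.isNoetherianRing k _
  have : IsReduced Y := isReduced_of_smooth π
  obtain ⟨s, hs, hsW'⟩ := exists_mem_nonZeroDivisors_basicOpen_le_of_isAffineOpen hV hd
  have : IsLocalization.Away s Γ(Y, Y.basicOpen s) := hV.isLocalization_basicOpen s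
  have hres : (Y.presheaf.map (homOfLE hsW').op).hom.comp (Y.presheaf.map (homOfLE h).op).hom =
      algebraMap Γ(Y, V) Γ(Y, Y.basicOpen s) := by
    rw [← CommRingCat.hom_comp, ← Y.presheaf.map_comp]
    rfl
  obtain ⟨y, hy⟩ := exists_algebraMap_eq_of_isIntegral_of_smooth k hs
    (x := Y.presheaf.map (homOfLE hsW').op x) (by
      obtain ⟨p, hp, hpx⟩ := hx
      refine ⟨p, hp, ?_⟩
      rw [← hres]
      exact (Polynomial.hom_eval₂ p _ (Y.presheaf.map (homOfLE hsW').op).hom x).symm.trans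
        ((congrArg _ hpx).trans (map_zero _)))
  refine ⟨y, map_injective_of_subset_closure hsW' ?_ ?_⟩
  · exact (SetLike.coe_subset_coe.mpr h).trans (subset_closure_basicOpen hV hs)
  · rw [← hy, ← hres]; rfl

/-- The extensions over affine opens are unique because `W` is dense, and therefore glue. -/
lemma exists_map_eq_of_isIntegralElem {Y : Scheme.{u}} (π : Y ⟶ Spec (.of k))
    [Smooth π] {W V : Y.Opens} (h : W ≤ V)
    (hd : (V : Set Y) ⊆ closure W) (x : Γ(Y, W))
    (hx : (Y.presheaf.map (homOfLE h).op).hom.IsIntegralElem x) :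
    ∃ y, Y.presheaf.map (homOfLE h).op y = x := by
  have : IsReduced Y := isReduced_of_smooth π
  let ι := {V' : Y.affineOpens // V'.1 ≤ V}
  have hle (i : ι) : W ⊓ i.1.1 ≤ i.1.1 := inf_le_right
  have hdi (U : Y.Opens) (hU : U ≤ V) : (U : Set Y) ⊆ closure (W ⊓ U : Y.Opens) := fun y hy =>
    mem_closure_iff.mpr fun T hT hyT => by
      obtain ⟨z, ⟨hz1, hz2⟩, hz3⟩ := mem_closure_iff.mp (hd (hU hy)) (T ∩ U) (hT.inter U.2) ⟨hyT, hy⟩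
      exact ⟨z, hz1, hz3, hz2⟩
  have hex (i : ι) : ∃ y, Y.presheaf.map (homOfLE (hle i)).op y =
      Y.presheaf.map (homOfLE (inf_le_left : W ⊓ i.1.1 ≤ W)).op x := by
    refine exists_map_eq_of_isIntegralElem_of_isAffineOpen π i.1.2 _ (hdi _ i.2) _ ?_
    obtain ⟨p, hp, hpx⟩ := hx
    refine ⟨p.map (Y.presheaf.map (homOfLE i.2).op).hom, hp.map _, ?_⟩
    have h2 := Polynomial.hom_eval₂ p (Y.presheaf.map (homOfLE h).op).hom
      (Y.presheaf.map (homOfLE (inf_le_left : W ⊓ i.1.1 ≤ W)).op).hom x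
    rw [Polynomial.eval₂_map, ← CommRingCat.hom_comp, ← Y.presheaf.map_comp]
    rw [hpx, map_zero, ← CommRingCat.hom_comp, ← Y.presheaf.map_comp] at h2
    exact h2.symm
  choose y hy using hex
  have hcov : V ≤ ⨆ i : ι, i.1.1 := fun z hz => by
    obtain ⟨U, hU, hzU, hUV⟩ := exists_isAffineOpen_mem_and_subset (x := z) (U := V) hz
    exact Opens.mem_iSup.mpr ⟨⟨⟨U, hU⟩, hUV⟩, hzU⟩
  obtain ⟨s, hs, -⟩ := Y.sheaf.existsUnique_gluing' (fun i : ι => i.1.1) V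
    (fun i => homOfLE i.2) hcov y (fun i j => by
      have hij : W ⊓ (i.1.1 ⊓ j.1.1) ≤ i.1.1 ⊓ j.1.1 := inf_le_right
      refine map_injective_of_subset_closure hij (hdi _ (inf_le_left.trans i.2)) ?_
      have e1 := congrArg (Y.presheaf.map (homOfLE (show W ⊓ (i.1.1 ⊓ j.1.1) ≤ W ⊓ i.1.1 from
        inf_le_inf_left _ inf_le_left)).op) (hy i)
      have e2 := congrArg (Y.presheaf.map (homOfLE (show W ⊓ (i.1.1 ⊓ j.1.1) ≤ W ⊓ j.1.1 from
        inf_le_inf_left _ inf_le_right)).op) (hy j)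
      rw [← CommRingCat.comp_apply, ← CommRingCat.comp_apply, ← Y.presheaf.map_comp,
        ← Y.presheaf.map_comp] at e1 e2
      have e3 := e1.trans e2.symm
      refine Eq.trans ?_ (e3.trans ?_)
      · exact map_map_apply hij inf_le_left (y i)
      · exact (map_map_apply hij inf_le_right (y j)).symm)
  refine ⟨s, ?_⟩
  refine Y.sheaf.eq_of_locally_eq' (fun i : ι => W ⊓ i.1.1) W (fun i => homOfLE inf_le_left)
    (fun z hz => ?_) _ _ fun i => ?_
  · obtain ⟨i, hi⟩ := Opens.mem_iSup.mp (hcov (h hz))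
    exact Opens.mem_iSup.mpr ⟨i, hz, hi⟩
  · refine Eq.trans ?_ (hy i)
    rw [← hs i]
    exact (map_map_apply inf_le_left h s).trans (map_map_apply (hle i) i.2 s).symm

/-- An integral morphism to a smooth scheme that is an isomorphism over a dense open subset is an
isomorphism. -/
lemma isIso_of_isIntegralHom {X Y : Scheme.{u}} [IsReduced X] (f : X ⟶ Y) [IsIntegralHom f]
    (π : Y ⟶ Spec (.of k)) [Smooth π] (D : Y.Opens) (hD : Dense (D : Set Y))
    (hfD : Dense (f ⁻¹ᵁ D : Set X)) (hf : ∀ V ≤ D, Function.Bijective (f.app V)) : IsIso f := by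
  have : IsReduced Y := isReduced_of_smooth π
  have key (V : Y.affineOpens) : IsIso (f.app V) := by
    rw [ConcreteCategory.isIso_iff_bijective]
    have hle : V.1 ⊓ D ≤ V.1 := inf_le_left
    have hle' : f ⁻¹ᵁ (V.1 ⊓ D) ≤ f ⁻¹ᵁ V.1 := (Opens.map f.base).monotone hle
    have hdY : (V.1 : Set Y) ⊆ closure (V.1 ⊓ D : Y.Opens) :=
      (hD.open_subset_closure_inter V.1.2)
    have hdX : (f ⁻¹ᵁ V.1 : Set X) ⊆ closure (f ⁻¹ᵁ (V.1 ⊓ D) : X.Opens) :=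
      (hfD.open_subset_closure_inter (f ⁻¹ᵁ V.1).2)
    have nat (y : Γ(Y, V)) : f.app (V.1 ⊓ D) (Y.presheaf.map (homOfLE hle).op y) =
        X.presheaf.map (homOfLE hle').op (f.app V y) :=
      congrArg (fun g => g.hom y) (f.naturality (homOfLE hle).op)
    have hb := hf (V.1 ⊓ D) inf_le_right
    refine ⟨fun a b hab => map_injective_of_subset_closure hle hdY (hb.1 ?_), fun x => ?_⟩
    · rw [nat, nat, hab]
    -- Over `D` the function `x` descends to `z`; the integral equation of `x` passes to `z`, which
    -- extends because `Y` is smooth.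
    · obtain ⟨z, hz⟩ := hb.2 (X.presheaf.map (homOfLE hle').op x)
      have hint := f.isIntegral_app V.1 V.2 x
      obtain ⟨y, hy⟩ := exists_map_eq_of_isIntegralElem_of_isAffineOpen π V.2 hle hdY z (by
        obtain ⟨p, hp, hpx⟩ := hint
        refine ⟨p, hp, hb.1 ?_⟩
        have h1 : ((f.app (V.1 ⊓ D)).hom.comp (Y.presheaf.map (homOfLE hle).op).hom) =
            (X.presheaf.map (homOfLE hle').op).hom.comp (f.app V).hom := RingHom.ext nat
        have h2 := Polynomial.hom_eval₂ p (Y.presheaf.map (homOfLE hle).op).hom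
          (f.app (V.1 ⊓ D)).hom z
        have h3 := Polynomial.hom_eval₂ p (f.app V).hom (X.presheaf.map (homOfLE hle').op).hom x
        rw [h1, hz, ← h3, hpx, map_zero] at h2
        exact h2.trans (map_zero _).symm)
      refine ⟨y, map_injective_of_subset_closure hle' hdX ?_⟩
      rw [← nat, hy, hz]
  refine (MorphismProperty.isomorphisms.iff f).mp
    ((IsZariskiLocalAtTarget.iff_of_iSup_eq_top (P := .isomorphisms _) (fun V : Y.affineOpens => V.1)
      (iSup_affineOpens_eq_top Y)).mpr fun V => ?_)
  exact (isIso_morphismRestrict_iff_isIso_app f V.2).mpr (key V)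

end Extension

/-! ### Sections and stalks of the quotient sheaf -/

section Quotient

open Opposite

/-- A monomorphism is the kernel of its cokernel, and taking sections over `U` preserves kernels. -/
lemma exists_app_eq_of_cokernel_app_eq_zero {k : Type u} [Field k] {T : Type u} [SmallCategory T]
    {J : GrothendieckTopology T} {F G : Sheaf J (ModuleCat.{u} k)} (φ : F ⟶ G) (hφ : Mono φ) (U : Tᵒᵖ)
    (t : G.obj.obj U) (ht : (Limits.cokernel.π φ).hom.app U t = 0) :
    ∃ a, φ.hom.app U a = t := by
  let S : ShortComplex (Sheaf J (ModuleCat.{u} k)) :=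
    ShortComplex.mk φ (Limits.cokernel.π φ) (Limits.cokernel.condition φ)
  have hS : S.Exact := ShortComplex.exact_cokernel φ
  let F : Sheaf J (ModuleCat.{u} k) ⥤ ModuleCat.{u} k :=
    sheafToPresheaf J (ModuleCat.{u} k) ⋙ (evaluation _ _).obj U
  have : F.PreservesZeroMorphisms := ⟨fun _ _ => rfl⟩
  have h1 : Limits.PreservesLimit (Limits.parallelPair S.g 0) F := Limits.comp_preservesLimit _ _
  exact (ShortComplex.moduleCat_exact_iff _).mp
    (hS.map_of_mono_of_preservesKernel F hφ h1) t ht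

variable {k : Type u} [Field k] {X Y : Scheme.{u}} (πX : X ⟶ Spec (.of k)) (πY : Y ⟶ Spec (.of k))
  (f : X ⟶ Y) (hf : f ≫ πY = πX)

/-- The projection of functions to the quotient sheaf `f_* 𝒪_X / 𝒪_Y`. -/
def toDelta (U : Y.Opens) :
    sections πX (f ⁻¹ᵁ U) →ₗ[k] (Delta πX πY f hf).obj.obj (op U) :=
  ((Limits.cokernel.π (sharp πX πY f hf)).hom.app (op U)).hom

lemma map_toDelta {U V : Y.Opens} (h : U ≤ V) (t : sections πX (f ⁻¹ᵁ V)) :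
    (Delta πX πY f hf).obj.map (homOfLE h).op (toDelta πX πY f hf V t) =
      toDelta πX πY f hf U (restriction πX (homOfLE ((Opens.map f.base).monotone h)) t) :=
  (ConcreteCategory.congr_hom
    ((Limits.cokernel.π (sharp πX πY f hf)).hom.naturality (homOfLE h).op) t).symm

lemma toDelta_pullbackSections (U : Y.Opens) (a : sections πY U) :
    toDelta πX πY f hf U (pullbackSections πX πY f hf U a) = 0 := by
  have := congrArg (fun g => g.hom.app (op U)) (Limits.cokernel.condition (sharp πX πY f hf))
  exact ConcreteCategory.congr_hom this a

lemma exists_pullbackSections_eq (hinj : ∀ U : Y.Opens, Function.Injective (f.app U))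
    (U : Y.Opens) (t : sections πX (f ⁻¹ᵁ U)) (ht : toDelta πX πY f hf U t = 0) :
    ∃ a, pullbackSections πX πY f hf U a = t := by
  have hm : Mono (sharp πX πY f hf).hom := by
    have (V : (Opens Y)ᵒᵖ) : Mono ((sharp πX πY f hf).hom.app V) :=
      (ModuleCat.mono_iff_injective _).mpr (hinj V.unop)
    exact NatTrans.mono_of_mono_app _
  have : Mono (sharp πX πY f hf) := Sheaf.Hom.mono_of_presheaf_mono _ _ _
  exact exists_app_eq_of_cokernel_app_eq_zero (sharp πX πY f hf) this (op U) t ht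

lemma exists_toDelta_eq (U : Y.Opens) (t : (Delta πX πY f hf).obj.obj (op U)) (x : Y)
    (hx : x ∈ U) : ∃ (V : Y.Opens) (h : V ≤ U), x ∈ V ∧
      ∃ s, toDelta πX πY f hf V s = (Delta πX πY f hf).obj.map (homOfLE h).op t := by
  have h1 := (TopCat.Sheaf.isLocallySurjective_iff_epi
    (Limits.cokernel.π (sharp πX πY f hf))).mpr inferInstance
  obtain ⟨V, hV, ⟨s, hs⟩, hxV⟩ := (TopCat.Presheaf.isLocallySurjective_iff _).mp h1 U t x hx
  exact ⟨V, hV, hxV, s, hs⟩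

lemma exists_map_eq_zero_of_germ_eq_zero {F : TopCat.Presheaf (ModuleCat.{u} k) Y} (U : Y.Opens)
    (t : F.obj (op U)) (x : Y) (hx : x ∈ U) (h : F.germ U x hx t = 0) :
    ∃ (V : Y.Opens) (h : V ≤ U), x ∈ V ∧ F.map (homOfLE h).op t = 0 := by
  obtain ⟨W, hxW, i, j, e⟩ := F.germ_eq x hx hx t 0 (h.trans (map_zero _).symm)
  exact ⟨W, i.le, hxW, e.trans (map_zero _)⟩

lemma eq_zero_of_locally_eq_zero (F : TopCat.Sheaf (ModuleCat.{u} k) Y) (U : Y.Opens)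
    (t : F.obj.obj (op U)) (h : ∀ x ∈ U, ∃ (V : Y.Opens) (h : V ≤ U), x ∈ V ∧
      F.obj.map (homOfLE h).op t = 0) : t = 0 := by
  choose V hVU hxV ht using h
  refine F.eq_of_locally_eq' (fun x : U => V x x.2) U (fun x => homOfLE (hVU x x.2))
    (fun x hx => Opens.mem_iSup.mpr ⟨⟨x, hx⟩, hxV x hx⟩) _ _ fun x => ?_
  rw [ht x x.2, map_zero]

/-- If the quotient sheaf vanishes on `U`, then `f` is an isomorphism over `U`. -/
lemma bijective_app_of_subsingleton_stalk (hinj : ∀ U : Y.Opens, Function.Injective (f.app U))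
    (U : Y.Opens) (hU : ∀ x ∈ U, Subsingleton ((Delta πX πY f hf).presheaf.stalk x)) :
    Function.Bijective (f.app U) := by
  refine ⟨hinj U, fun t => ?_⟩
  have hloc (x : Y) (hx : x ∈ U) : ∃ (V : Y.Opens) (h : V ≤ U), x ∈ V ∧ ∃ a : Γ(Y, V),
      f.app V a = X.presheaf.map (homOfLE ((Opens.map f.base).monotone h)).op t := by
    have := hU x hx
    obtain ⟨V, hVU, hxV, h0⟩ := exists_map_eq_zero_of_germ_eq_zero U
      (toDelta πX πY f hf U t) x hx (Subsingleton.elim _ _)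
    exact ⟨V, hVU, hxV, exists_pullbackSections_eq πX πY f hf hinj V _
      ((map_toDelta πX πY f hf hVU t).symm.trans h0)⟩
  choose V hVU hxV a ha using hloc
  have nat {U V : Y.Opens} (h : U ≤ V) (y : Γ(Y, V)) :
      f.app U (Y.presheaf.map (homOfLE h).op y) =
        X.presheaf.map (homOfLE ((Opens.map f.base).monotone h)).op (f.app V y) :=
      congrArg (fun g => g.hom y) (f.naturality (homOfLE h).op)
  have hcov : U ≤ ⨆ x : U, V x x.2 := fun x hx => Opens.mem_iSup.mpr ⟨⟨x, hx⟩, hxV x hx⟩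
  obtain ⟨s, hs, -⟩ := Y.sheaf.existsUnique_gluing' (fun x : U => V x x.2) U
    (fun x => homOfLE (hVU x x.2)) hcov (fun x => a x x.2) (fun x y => hinj _ (by
      refine (nat inf_le_left _).trans (Eq.trans ?_ (nat inf_le_right _).symm)
      rw [ha, ha]
      exact (map_map_apply _ _ t).trans (map_map_apply _ _ t).symm))
  refine ⟨s, ?_⟩
  refine X.sheaf.eq_of_locally_eq' (fun x : U => f ⁻¹ᵁ (V x x.2)) (f ⁻¹ᵁ U)
    (fun x => homOfLE ((Opens.map f.base).monotone (hVU x x.2)))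
    (fun z hz => ?_) _ _ fun x => ?_
  · obtain ⟨i, hi⟩ := Opens.mem_iSup.mp (hcov hz)
    exact Opens.mem_iSup.mpr ⟨i, hi⟩
  · refine (nat (hVU x x.2) s).symm.trans (Eq.trans ?_ (ha x x.2))
    exact congrArg _ (hs x)

lemma toDelta_eq_zero_of_bijective {U : Y.Opens} (h : Function.Bijective (f.app U))
    (t : sections πX (f ⁻¹ᵁ U)) : toDelta πX πY f hf U t = 0 := by
  obtain ⟨a, ha⟩ := h.2 t
  subst ha
  exact toDelta_pullbackSections πX πY f hf U a

lemma eq_zero_of_bijective_app {U : Y.Opens} (h : ∀ V ≤ U, Function.Bijective (f.app V))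
    (t : (Delta πX πY f hf).obj.obj (op U)) : t = 0 := by
  refine eq_zero_of_locally_eq_zero _ U t fun x hx => ?_
  obtain ⟨V, hVU, hxV, s, hs⟩ := exists_toDelta_eq πX πY f hf U t x hx
  exact ⟨V, hVU, hxV, hs.symm.trans (toDelta_eq_zero_of_bijective πX πY f hf (h V hVU) s)⟩

/-- If `f` is an isomorphism over `U`, then the quotient sheaf vanishes on `U`. -/
lemma subsingleton_stalk_of_bijective_app {U : Y.Opens}
    (h : ∀ V ≤ U, Function.Bijective (f.app V)) {x : Y} (hx : x ∈ U) :
    Subsingleton ((Delta πX πY f hf).presheaf.stalk x) := by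
  refine subsingleton_of_forall_eq 0 fun t => ?_
  obtain ⟨V, hVU, hxV, s, rfl⟩ := TopCat.Presheaf.exists_le_germ_eq
    (Delta πX πY f hf).presheaf t hx
  rw [eq_zero_of_bijective_app πX πY f hf (fun W hW => h W (hW.trans hVU)) s, map_zero]

end Quotient

/-! ### Uniqueness of smooth models and of lifts to them -/

section Lift

/-- Quasi-finite fibres are discrete, so they contain no proper specialization. -/
lemma eq_of_specializes_of_locallyQuasiFinite {X Y : Scheme.{u}} (f : X ⟶ Y)
    [LocallyQuasiFinite f] {x y : X} (h : x ⤳ y) (e : f x = f y) : x = y := by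
  have : DiscreteTopology (f ⁻¹' {f y}) := (f.isDiscrete_preimage_singleton (f y)).to_subtype
  have h' : (⟨x, e⟩ : f ⁻¹' {f y}) ⤳ ⟨y, rfl⟩ := subtype_specializes_iff _ _ |>.mpr h
  exact congrArg Subtype.val h'.eq

lemma isClosed_singleton_of_locallyQuasiFinite {X Y : Scheme.{u}} (f : X ⟶ Y)
    [LocallyQuasiFinite f] {x : X} (h : IsClosed {f x}) : IsClosed {x} :=
  isClosed_singleton_of_forall_specializes fun _ hy =>
    (eq_of_specializes_of_locallyQuasiFinite f hy ((hy.map f.continuous).mem_closed h rfl).symm).symm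

lemma bijective_morphismRestrict_app {X Y : Scheme.{u}} (f : X ⟶ Y) (U : Y.Opens)
    (V : U.toScheme.Opens) (h : Function.Bijective (f.app (U.ι ''ᵁ V))) :
    Function.Bijective ((f ∣_ U).app V) := by
  rw [morphismRestrict_app]
  exact (ConcreteCategory.bijective_of_isIso (X.presheaf.map
    (eqToHom (image_morphismRestrict_preimage f U V)).op)).comp h

lemma isIso_morphismRestrict_of_bijective {X Y : Scheme.{u}} (f : X ⟶ Y) [IsAffineHom f]
    (U : Y.Opens) (h : ∀ V ≤ U, Function.Bijective (f.app V)) : IsIso (f ∣_ U) := by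
  have : IsAffineHom (f ∣_ U) := MorphismProperty.of_isPullback (isPullback_morphismRestrict f U).flip ‹_›
  refine (MorphismProperty.isomorphisms.iff _).mp
    ((IsZariskiLocalAtTarget.iff_of_iSup_eq_top (P := .isomorphisms _)
      (fun V : U.toScheme.affineOpens => V.1) (iSup_affineOpens_eq_top _)).mpr fun V => ?_)
  refine (isIso_morphismRestrict_iff_isIso_app _ V.2).mpr ?_
  rw [ConcreteCategory.isIso_iff_bijective]
  exact bijective_morphismRestrict_app f U V.1 (h _ (U.ι_image_le V))

variable {k : Type u} [Field k]

lemma smooth_smoothLocus_ι {X : Scheme.{u}} (π : X ⟶ Spec (.of k))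
    [LocallyOfFinitePresentation π] : Smooth (π.smoothLocus.ι ≫ π) := by
  rw [← Scheme.Hom.smoothLocus_eq_top_iff, ← Scheme.Hom.preimage_smoothLocus_eq]
  simp

/-- An integral morphism that is an isomorphism over a dense open subset is an isomorphism over the
smooth locus. -/
lemma isIso_morphismRestrict_smoothLocus {X Y : Scheme.{u}} [IsReduced X] (f : X ⟶ Y)
    [IsIntegralHom f] (π : Y ⟶ Spec (.of k)) [LocallyOfFinitePresentation π] {U : Y.Opens}
    (hU : Dense (U : Set Y)) (hfU : Dense (f ⁻¹ᵁ U : Set X))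
    (h : ∀ V ≤ U, Function.Bijective (f.app V)) : IsIso (f ∣_ π.smoothLocus) := by
  have := smooth_smoothLocus_ι π
  refine isIso_of_isIntegralHom _ (π.smoothLocus.ι ≫ π) (π.smoothLocus.ι ⁻¹ᵁ U) ?_ ?_
    fun V hV => bijective_morphismRestrict_app f _ V (h _ ?_)
  · exact hU.preimage π.smoothLocus.ι.isOpenEmbedding.isOpenMap
  · rw [← Scheme.Hom.comp_preimage, morphismRestrict_ι, Scheme.Hom.comp_preimage]
    exact hfU.preimage (f ⁻¹ᵁ π.smoothLocus).ι.isOpenEmbedding.isOpenMap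
  · exact (Scheme.Hom.image_mono _ hV).trans (Scheme.Hom.image_preimage_le _ _)

/-- A smooth scheme finite over a reduced scheme and isomorphic to it over a dense open subset is the
normalization. -/
lemma exists_normalization_iso {X Y : Scheme.{u}} [IsReduced Y] (f : X ⟶ Y) [IsIntegralHom f]
    (π : X ⟶ Spec (.of k)) [Smooth π] {U : Y.Opens} [QuasiCompact U.ι]
    (hfU : Dense (f ⁻¹ᵁ U : Set X)) (h : ∀ V ≤ U, Function.Bijective (f.app V)) :
    ∃ e : U.ι.normalization ≅ X, e.hom ≫ f = U.ι.fromNormalization := by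
  have := isIso_morphismRestrict_of_bijective f U h
  -- This section factors `U.ι` through the integral morphism `f`, so the universal property of the
  -- normalization gives `g`. It is integral and bijective on functions over the preimage of `U`,
  -- hence an isomorphism as `X` is smooth.
  let s : U.toScheme ⟶ X := inv (f ∣_ U) ≫ (f ⁻¹ᵁ U).ι
  have hs : U.ι = s ≫ f := by
    rw [Category.assoc, ← morphismRestrict_ι, IsIso.inv_hom_id_assoc]
  let g := U.ι.normalizationDesc s f hs
  have hg : U.ι.toNormalization ≫ g = s := U.ι.toNormalization_normalizationDesc s f hs
  have : IsSchemeTheoreticallyDominant U.ι.toNormalization := .of_isDominant _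
  have : IsIso g := by
    refine isIso_of_isIntegralHom g π (f ⁻¹ᵁ U) hfU ?_ fun V hV => ?_
    · refine U.ι.toNormalization.denseRange.mono ?_
      rintro _ ⟨x, rfl⟩
      change f (g (U.ι.toNormalization x)) ∈ U
      rw [← Scheme.Hom.comp_apply U.ι.toNormalization g, hg, ← Scheme.Hom.comp_apply, ← hs]
      exact x.2
    · have hsV : Function.Bijective (s.app V) := by
        rw [Scheme.Hom.comp_app]
        have := (f ⁻¹ᵁ U).ι.isIso_app V (by simpa)
        exact (ConcreteCategory.bijective_of_isIso ((inv (f ∣_ U)).app _)).comp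
          (ConcreteCategory.bijective_of_isIso ((f ⁻¹ᵁ U).ι.app V))
      have hinj := U.ι.toNormalization.app_injective (g ⁻¹ᵁ V)
      have hc : ⇑(U.ι.toNormalization.app (g ⁻¹ᵁ V)) ∘ ⇑(g.app V) =
          ⇑((U.ι.toNormalization ≫ g).app V) := by
        rw [Scheme.Hom.comp_app]
        rfl
      have hb : Function.Bijective ((U.ι.toNormalization ≫ g).app V) := by rwa [hg]
      rw [← hc] at hb
      exact ⟨hb.1.of_comp, hb.2.of_comp_left hinj⟩
  exact ⟨asIso g, U.ι.normalizationDesc_comp s f hs⟩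

lemma exists_iso_of_bijective {X X' Y : Scheme.{u}} [IsReduced Y] (f : X ⟶ Y) [IsIntegralHom f]
    (π : X ⟶ Spec (.of k)) [Smooth π] (f' : X' ⟶ Y) [IsIntegralHom f']
    (π' : X' ⟶ Spec (.of k)) [Smooth π'] {U : Y.Opens} [QuasiCompact U.ι]
    (hfU : Dense (f ⁻¹ᵁ U : Set X)) (h : ∀ V ≤ U, Function.Bijective (f.app V))
    (hfU' : Dense (f' ⁻¹ᵁ U : Set X')) (h' : ∀ V ≤ U, Function.Bijective (f'.app V)) :
    ∃ e : X ≅ X', e.hom ≫ f' = f := by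
  obtain ⟨e, he⟩ := exists_normalization_iso f π hfU h
  obtain ⟨e', he'⟩ := exists_normalization_iso f' π' hfU' h'
  exact ⟨e.symm ≪≫ e', by simp [he', ← he]⟩

/-- Two morphisms to `Y` that agree over `Z` are equal when `Y ⟶ Z` is an isomorphism over an open
subset with dense preimage. -/
lemma eq_of_comp_eq_of_isIso_restrict {X Y Z : Scheme.{u}} [IsReduced X] (f : Y ⟶ Z)
    [IsSeparated f] (U : Z.Opens) [IsIso (f ∣_ U)] {a b : X ⟶ Y} (hab : a ≫ f = b ≫ f)
    (hd : Dense ((a ≫ f) ⁻¹ᵁ U : Set X)) : a = b := by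
  have hm : Mono ((f ⁻¹ᵁ U).ι ≫ f) := by
    rw [← morphismRestrict_ι]
    infer_instance
  let W : X.Opens := (a ≫ f) ⁻¹ᵁ U
  have : IsDominant W.ι := ⟨by
    rw [DenseRange, Scheme.Opens.range_ι]
    exact hd⟩
  have key (c : X ⟶ Y) (hc : c ≫ f = a ≫ f) : ∃ l : W.toScheme ⟶ (f ⁻¹ᵁ U).toScheme,
      l ≫ (f ⁻¹ᵁ U).ι = W.ι ≫ c := by
    refine ⟨IsOpenImmersion.lift (f ⁻¹ᵁ U).ι (W.ι ≫ c) ?_, IsOpenImmersion.lift_fac _ _ _⟩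
    rintro _ ⟨x, rfl⟩
    rw [Scheme.Opens.range_ι]
    change f ((W.ι ≫ c) x) ∈ U
    rw [← Scheme.Hom.comp_apply, Category.assoc, hc]
    exact x.2
  obtain ⟨l, hl⟩ := key a rfl
  obtain ⟨m, hm'⟩ := key b hab.symm
  refine ext_of_isDominant_of_isSeparated f hab W.ι ?_
  rw [← hl, ← hm', (cancel_mono ((f ⁻¹ᵁ U).ι ≫ f)).mp (show l ≫ _ = m ≫ _ by
    rw [reassoc_of% hl, reassoc_of% hm', hab])]

end Lift

/-! ### Relative normalization in a dense open subset -/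

section Normalization

lemma injective_app_of_comp_eq {X Y Z : Scheme.{u}} {t : X ⟶ Y} {f : Y ⟶ Z} {g : X ⟶ Z}
    (h : t ≫ f = g) {V : Z.Opens} (hg : Function.Injective (g.app V)) :
    Function.Injective (f.app V) := by
  subst h
  rw [Scheme.Hom.comp_app] at hg
  exact Function.Injective.of_comp (f := t.app (f ⁻¹ᵁ V)) hg

lemma bijective_app_of_comp_eq {X Y Z : Scheme.{u}} {t : X ⟶ Y} {f : Y ⟶ Z} {g : X ⟶ Z}
    (h : t ≫ f = g) {V : Z.Opens} (ht : Function.Injective (t.app (f ⁻¹ᵁ V)))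
    (hg : Function.Bijective (g.app V)) : Function.Bijective (f.app V) := by
  refine ⟨injective_app_of_comp_eq h hg.1, ?_⟩
  subst h
  rw [Scheme.Hom.comp_app] at hg
  exact Function.Surjective.of_comp_left (g := f.app V) hg.2 ht

variable {Y : Scheme.{u}} (U : Y.Opens) [QuasiCompact U.ι]

lemma fromNormalization_toNormalization_apply (x : U.toScheme) :
    U.ι.fromNormalization (U.ι.toNormalization x) = U.ι x := by
  rw [← Scheme.Hom.comp_apply, U.ι.toNormalization_fromNormalization]

/-- Sections of the normalization are the integral sections. -/
lemma exists_toNormalization_appLE_eq {V : Y.Opens} (hV : IsAffineOpen V)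
    (e : U.ι ⁻¹ᵁ V ≤ U.ι.toNormalization ⁻¹ᵁ (U.ι.fromNormalization ⁻¹ᵁ V))
    (y : Γ(U, U.ι ⁻¹ᵁ V)) (hy : (U.ι.app V).hom.IsIntegralElem y) :
    ∃ b, U.ι.toNormalization.appLE (U.ι.fromNormalization ⁻¹ᵁ V) (U.ι ⁻¹ᵁ V) e b = y := by
  let := (U.ι.app V).hom.toAlgebra
  refine ⟨(U.ι.normalizationObjIso hV).inv ⟨y, hy⟩, ?_⟩
  rw [← U.ι.normalizationObjIso_hom_val hV]
  exact congrArg Subtype.val (ConcreteCategory.congr_hom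
    (U.ι.normalizationObjIso hV).inv_hom_id (⟨y, hy⟩ : integralClosure Γ(Y, V) Γ(U, U.ι ⁻¹ᵁ V)))

lemma toNormalization_mem (x : U.toScheme) :
    U.ι.toNormalization x ∈ U.ι.fromNormalization ⁻¹ᵁ U := by
  change U.ι.fromNormalization (U.ι.toNormalization x) ∈ U
  rw [fromNormalization_toNormalization_apply]
  exact x.2

lemma subset_closure_fromNormalization_preimage {V W : Y.Opens} (h : (V : Set Y) ⊆ closure W) :
    (U.ι.fromNormalization ⁻¹ᵁ V : Set U.ι.normalization) ⊆
      closure (U.ι.fromNormalization ⁻¹ᵁ W) := by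
  refine fun x hx => mem_closure_iff.mpr fun T hT hxT => ?_
  obtain ⟨_, ⟨hyT, hyV⟩, y, rfl⟩ := mem_closure_iff.mp (U.ι.toNormalization.denseRange x)
    (T ∩ U.ι.fromNormalization ⁻¹ᵁ V) (hT.inter (U.ι.fromNormalization ⁻¹ᵁ V).2) ⟨hxT, hx⟩
  have hyV' : U.ι y ∈ V := fromNormalization_toNormalization_apply U y ▸ hyV
  obtain ⟨_, ⟨z, hzT, rfl⟩, hzW⟩ := mem_closure_iff.mp (h hyV') _
    (U.ι.isOpenEmbedding.isOpenMap _ (hT.preimage U.ι.toNormalization.continuous)) ⟨y, hyT, rfl⟩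
  refine ⟨_, hzT, ?_⟩
  change U.ι.fromNormalization (U.ι.toNormalization z) ∈ W
  rwa [fromNormalization_toNormalization_apply]

lemma dense_fromNormalization_preimage :
    Dense (U.ι.fromNormalization ⁻¹ᵁ U : Set U.ι.normalization) :=
  U.ι.toNormalization.denseRange.mono (by rintro _ ⟨x, rfl⟩; exact toNormalization_mem U x)

variable [IsReduced Y]

lemma injective_toNormalization_app (V : U.ι.normalization.Opens) :
    Function.Injective (U.ι.toNormalization.app V) := by
  have : IsSchemeTheoreticallyDominant U.ι.toNormalization := .of_isDominant _
  exact U.ι.toNormalization.app_injective V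

lemma injective_fromNormalization_app (hU : Dense (U : Set Y)) (V : Y.Opens) :
    Function.Injective (U.ι.fromNormalization.app V) := by
  have : IsDominant U.ι := ⟨by rw [DenseRange, Scheme.Opens.range_ι]; exact hU⟩
  have : IsSchemeTheoreticallyDominant U.ι := .of_isDominant _
  exact injective_app_of_comp_eq U.ι.toNormalization_fromNormalization (U.ι.app_injective V)

lemma bijective_fromNormalization_app {V : Y.Opens} (hV : V ≤ U) :
    Function.Bijective (U.ι.fromNormalization.app V) := by
  have := U.ι.isIso_app V (by simpa)
  exact bijective_app_of_comp_eq U.ι.toNormalization_fromNormalization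
    (injective_toNormalization_app U _) (ConcreteCategory.bijective_of_isIso (U.ι.app V))

instance isIso_fromNormalization_restrict : IsIso (U.ι.fromNormalization ∣_ U) :=
  isIso_morphismRestrict_of_bijective _ U fun _ hV => bijective_fromNormalization_app U hV

/-- Both sides lift `U.ι` through a separated morphism that is an isomorphism over `U`. The
right-hand side is visibly an open immersion. -/
lemma toNormalization_eq : U.ι.toNormalization =
    inv (U.ι.fromNormalization ∣_ U) ≫ (U.ι.fromNormalization ⁻¹ᵁ U).ι := by
  have h : (inv (U.ι.fromNormalization ∣_ U) ≫ (U.ι.fromNormalization ⁻¹ᵁ U).ι) ≫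
      U.ι.fromNormalization = U.ι := by
    rw [Category.assoc, ← morphismRestrict_ι, IsIso.inv_hom_id_assoc]
  refine eq_of_comp_eq_of_isIso_restrict U.ι.fromNormalization U
    (U.ι.toNormalization_fromNormalization.trans h.symm) ?_
  rw [U.ι.toNormalization_fromNormalization]
  simp

instance isOpenImmersion_toNormalization : IsOpenImmersion U.ι.toNormalization := by
  rw [toNormalization_eq]
  infer_instance

lemma exists_toNormalization_eq {x : U.ι.normalization} (hx : U.ι.fromNormalization x ∈ U) :
    ∃ y, U.ι.toNormalization y = x := by
  refine ⟨(U.ι.fromNormalization ∣_ U) ⟨x, hx⟩, ?_⟩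
  refine (Scheme.Hom.comp_apply _ _ _).symm.trans ?_
  rw [toNormalization_eq, IsIso.hom_inv_id_assoc]
  rfl

variable {k : Type u} [Field k]

/-- Integrality is built in. For finiteness, pick a nonzerodivisor `s` on the affine `V` with basic
open set inside `U`; the sections of the normalization embed in the localization at `s`, and
`finite_of_injective_away` applies. -/
lemma isFinite_fromNormalization [PerfectField k] (π : Y ⟶ Spec (.of k)) [LocallyOfFiniteType π]
    (hU : Dense (U : Set Y)) : IsFinite U.ι.fromNormalization := by
  refine ⟨fun V hV => ?_⟩
  let ν := U.ι.fromNormalization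
  let := (scalars π V).toAlgebra
  have : Algebra.FiniteType k Γ(Y, V) := finiteType_scalars π hV
  have : IsNoetherianRing Γ(Y, V) := Algebra.FiniteType.isNoetherianRing k _
  obtain ⟨s, hs, hsU'⟩ := exists_mem_nonZeroDivisors_basicOpen_le_of_isAffineOpen hV (W := U)
    fun x _ => hU x
  have hle : Y.basicOpen s ≤ V := Y.basicOpen_le s
  have : IsLocalization.Away s Γ(Y, Y.basicOpen s) := hV.isLocalization_basicOpen s
  let := (ν.app V).hom.toAlgebra
  have : Algebra.IsIntegral Γ(Y, V) Γ(U.ι.normalization, ν ⁻¹ᵁ V) := ⟨ν.isIntegral_app V hV⟩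
  let hle' : ν ⁻¹ᵁ Y.basicOpen s ≤ ν ⁻¹ᵁ V := (Opens.map ν.base).monotone hle
  let e := RingEquiv.ofBijective (ν.app (Y.basicOpen s)).hom (bijective_fromNormalization_app U hsU')
  let i : Γ(U.ι.normalization, ν ⁻¹ᵁ V) →+* Γ(Y, Y.basicOpen s) :=
    e.symm.toRingHom.comp (U.ι.normalization.presheaf.map (homOfLE hle').op).hom
  have hi : Function.Injective i := by
    refine e.symm.injective.comp (map_injective_of_subset_closure hle' ?_)
    exact subset_closure_fromNormalization_preimage U (subset_closure_basicOpen hV hs)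
  refine finite_of_injective_away k hs (L := Γ(Y, Y.basicOpen s))
    ({ i with commutes' := fun a => ?_ } : Γ(U.ι.normalization, ν ⁻¹ᵁ V) →ₐ[Γ(Y, V)] _) hi
  refine (RingEquiv.symm_apply_eq e).mpr ?_
  exact (ConcreteCategory.congr_hom (ν.naturality (homOfLE hle).op) a).symm

end Normalization

/-! ### Purity and smoothness of the normalization -/

section NormalizationSmooth

lemma app_comp_map_comp_app {X Y Z : Scheme.{u}} {t : X ⟶ Y} {f : Y ⟶ Z} {g : X ⟶ Z}
    (h : t ≫ f = g) {V : Z.Opens} {D : Y.Opens} (hD : D ≤ f ⁻¹ᵁ V) (hW : t ⁻¹ᵁ D ≤ g ⁻¹ᵁ V) :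
    f.app V ≫ Y.presheaf.map (homOfLE hD).op ≫ t.app D =
      g.app V ≫ X.presheaf.map (homOfLE hW).op := by
  subst h
  simp

variable {k : Type u} [Field k] {Y : Scheme.{u}} [IsReduced Y] (U : Y.Opens) [QuasiCompact U.ι]
  (π : Y ⟶ Spec (.of k))

/-- Sections of the normalization defined away from a nonzerodivisor extend as soon as they are
integral. -/
lemma exists_map_eq_of_isIntegralElem_normalization [Smooth (U.ι ≫ π)]
    {V : Y.Opens} (hV : IsAffineOpen V) {s : Γ(U.ι.normalization, U.ι.fromNormalization ⁻¹ᵁ V)}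
    (hs : s ∈ nonZeroDivisors Γ(U.ι.normalization, U.ι.fromNormalization ⁻¹ᵁ V))
    (x : Γ(U.ι.normalization, U.ι.normalization.basicOpen s))
    (hx : (U.ι.normalization.presheaf.map
      (homOfLE (U.ι.normalization.basicOpen_le s)).op).hom.IsIntegralElem x) :
    ∃ y, U.ι.normalization.presheaf.map (homOfLE (U.ι.normalization.basicOpen_le s)).op y = x := by
  let N := U.ι.normalization
  let ν : N ⟶ Y := U.ι.fromNormalization
  let t : U.toScheme ⟶ N := U.ι.toNormalization
  have ht : t ≫ ν = U.ι := U.ι.toNormalization_fromNormalization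
  let W : U.toScheme.Opens := t ⁻¹ᵁ N.basicOpen s
  have e : U.ι ⁻¹ᵁ V ≤ t ⁻¹ᵁ (ν ⁻¹ᵁ V) := by
    rw [← Scheme.Hom.comp_preimage, ht]
  have hWV : W ≤ U.ι ⁻¹ᵁ V := by
    rw [← ht, Scheme.Hom.comp_preimage]
    exact (Opens.map t.base).monotone (N.basicOpen_le s)
  have hd : (U.ι ⁻¹ᵁ V : Set U.toScheme) ⊆ closure W := by
    have h1 := subset_closure_basicOpen (hV.preimage ν) hs
    intro z hz
    have : z ∈ t ⁻¹' closure (N.basicOpen s : Set N) := h1 (e hz)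
    rwa [t.isOpenEmbedding.isOpenMap.preimage_closure_eq_closure_preimage t.continuous] at this
  have hcomp : ν.app V ≫ N.presheaf.map (homOfLE (N.basicOpen_le s)).op ≫ t.app (N.basicOpen s) =
      U.ι.app V ≫ U.toScheme.presheaf.map (homOfLE hWV).op := by
    refine app_comp_map_comp_app ht (N.basicOpen_le s) hWV
  obtain ⟨p, hp, hpx⟩ : ((N.presheaf.map (homOfLE (N.basicOpen_le s)).op).hom.comp
      (ν.app V).hom).IsIntegralElem x := by
    algebraize [(ν.app V).hom, (N.presheaf.map (homOfLE (N.basicOpen_le s)).op).hom,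
      (N.presheaf.map (homOfLE (N.basicOpen_le s)).op).hom.comp (ν.app V).hom]
    have : Algebra.IsIntegral Γ(Y, V) Γ(N, ν ⁻¹ᵁ V) := ⟨ν.isIntegral_app V hV⟩
    exact isIntegral_trans (R := Γ(Y, V)) (A := Γ(N, ν ⁻¹ᵁ V)) x hx
  have hpx' : p.eval₂ ((U.toScheme.presheaf.map (homOfLE hWV).op).hom.comp (U.ι.app V).hom)
      (t.app (N.basicOpen s) x) = 0 := by
    have h1 := Polynomial.hom_eval₂ p ((N.presheaf.map (homOfLE (N.basicOpen_le s)).op).hom.comp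
      (ν.app V).hom) (t.app (N.basicOpen s)).hom x
    rw [hpx, map_zero] at h1
    rw [h1]
    exact congrArg (fun φ : Γ(Y, V) ⟶ Γ(U, W) => p.eval₂ φ.hom (t.app (N.basicOpen s) x)) hcomp.symm
  -- By transitivity `x` is integral over `Γ(Y, V)`. It is extended first over the smooth scheme
  -- `U`; the extension is still integral over `Γ(Y, V)`, so it comes from a section of the
  -- normalization.
  obtain ⟨y, hy⟩ := exists_map_eq_of_isIntegralElem (U.ι ≫ π) hWV hd (t.app (N.basicOpen s) x)
    ⟨p.map (U.ι.app V).hom, hp.map _, by rwa [Polynomial.eval₂_map]⟩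
  obtain ⟨b, hb⟩ := exists_toNormalization_appLE_eq U hV e y ⟨p, hp, by
    refine map_injective_of_subset_closure hWV hd ?_
    have h1 := Polynomial.hom_eval₂ p (U.ι.app V).hom
      (U.toScheme.presheaf.map (homOfLE hWV).op).hom y
    rw [hy, hpx'] at h1
    exact h1.trans (map_zero _).symm⟩
  refine ⟨b, injective_toNormalization_app U _ ?_⟩
  rw [← hy, ← hb]
  have h2 : N.presheaf.map (homOfLE (N.basicOpen_le s)).op ≫ t.app (N.basicOpen s) =
      t.appLE (ν ⁻¹ᵁ V) (U.ι ⁻¹ᵁ V) e ≫ U.toScheme.presheaf.map (homOfLE hWV).op := by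
    simp only [Scheme.Hom.app_eq_appLE, Scheme.Hom.appLE_map, Scheme.Hom.map_appLE]
    rfl
  exact ConcreteCategory.congr_hom h2 b

/-- The normalization of a scheme of pure dimension one is of pure dimension one. -/
lemma pureOneDimensional_normalization [NoetherianSpace U.ι.normalization]
    [IsFinite U.ι.fromNormalization] (h : PureOneDimensional Y) :
    PureOneDimensional U.ι.normalization := by
  refine h.of_isClosedMap U.ι.fromNormalization U.ι.fromNormalization.continuous
    U.ι.fromNormalization.isClosedMap
    (fun x y => eq_of_specializes_of_locallyQuasiFinite U.ι.fromNormalization) U.2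
    (dense_fromNormalization_preimage U) fun x hx y hy => ?_
  obtain ⟨x', rfl⟩ := exists_toNormalization_eq U hx
  rw [fromNormalization_toNormalization_apply] at hy
  have hyU : y ∈ U := hy.mem_open U.2 x'.2
  refine ⟨U.ι.toNormalization ⟨y, hyU⟩, ?_, fromNormalization_toNormalization_apply U _⟩
  refine Specializes.map ?_ U.ι.toNormalization.continuous
  exact (subtype_specializes_iff _ _).mpr hy

lemma mem_smoothLocus_of_isSmoothAt {X : Scheme.{u}} (π : X ⟶ Spec (.of k))
    [LocallyOfFinitePresentation π] {W : X.Opens} (hW : IsAffineOpen W) {x : X} (hx : x ∈ W)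
    (h : letI := (scalars π W).toAlgebra
      Algebra.IsSmoothAt k (hW.primeIdealOf ⟨x, hx⟩).asIdeal) : x ∈ π.smoothLocus := by
  rw [Scheme.Hom.mem_smoothLocus, formallySmooth_stalkMap_iff ⊤ (isAffineOpen_top _) W hW le_top hx]
  let := (scalars π W).toAlgebra
  let := (π.appLE ⊤ W le_top).hom.toAlgebra
  let := (Scheme.ΓSpecIso (.of k)).inv.hom.toAlgebra
  have : IsScalarTower k Γ(Spec (.of k), ⊤) Γ(X, W) := .of_algebraMap_eq' (scalars_eq π W)
  have : Algebra.FormallyEtale k Γ(Spec (.of k), ⊤) := .of_equiv (AlgEquiv.ofBijective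
    (Algebra.ofId k Γ(Spec (.of k), ⊤))
    (ConcreteCategory.bijective_of_isIso (Scheme.ΓSpecIso (.of k)).inv))
  exact (Algebra.FormallySmooth.iff_restrictScalars (R := k)).mp h

lemma le_smoothLocus {X : Scheme.{u}} (π : X ⟶ Spec (.of k)) [LocallyOfFinitePresentation π]
    (W : X.Opens) [Smooth (W.ι ≫ π)] : W ≤ π.smoothLocus := by
  have h := Scheme.Hom.smoothLocus_eq_top (W.ι ≫ π)
  rw [← Scheme.Hom.preimage_smoothLocus_eq] at h
  intro x hx
  have : (⟨x, hx⟩ : W.toScheme) ∈ W.ι ⁻¹ᵁ π.smoothLocus := by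
    rw [h]
    trivial
  exact this

/-- A closed point of a reduced scheme of pure dimension one is smooth if functions around this
point satisfy the extension property of integrally closed rings. -/
lemma mem_smoothLocus_of_exists_map_eq [IsAlgClosed k] {X : Scheme.{u}} [IsReduced X]
    (π : X ⟶ Spec (.of k)) [LocallyOfFinitePresentation π] (hX : PureOneDimensional X)
    {W : X.Opens} (hW : IsAffineOpen W) {x : X} (hxW : x ∈ W) (hx : IsClosed {x}) {D : X.Opens}
    (hD : Dense (D : Set X)) (hxD : x ∉ D)
    (h : ∀ s ∈ nonZeroDivisors Γ(X, W), ∀ f : Γ(X, X.basicOpen s),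
      (X.presheaf.map (homOfLE (X.basicOpen_le s)).op).hom.IsIntegralElem f →
        ∃ y, X.presheaf.map (homOfLE (X.basicOpen_le s)).op y = f) : x ∈ π.smoothLocus := by
  refine mem_smoothLocus_of_isSmoothAt π hW hxW ?_
  let := (scalars π W).toAlgebra
  have : Algebra.FiniteType k Γ(X, W) := finiteType_scalars π hW
  have : IsNoetherianRing Γ(X, W) := Algebra.FiniteType.isNoetherianRing k _
  obtain ⟨s, hs, hsD⟩ := exists_mem_nonZeroDivisors_basicOpen_le_of_isAffineOpen hW
    (W := D) fun x _ => hD x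
  have := hW.primeIdealOf_isMaximal_of_isClosed ⟨x, hxW⟩ hx
  have hmx : hW.fromSpec (hW.primeIdealOf ⟨x, hxW⟩) = x := hW.fromSpec_primeIdealOf ⟨x, hxW⟩
  generalize hW.primeIdealOf ⟨x, hxW⟩ = m at *
  have hsm : s ∈ m.asIdeal := by
    by_contra h
    have : m ∈ hW.fromSpec ⁻¹ᵁ X.basicOpen s := by
      rw [hW.fromSpec_preimage_basicOpen]
      exact h
    exact hxD (hmx ▸ hsD this)
  have := hW.isLocalization_basicOpen s
  -- Dimension one enters here: `s` lies in no minimal prime, so a prime below `m` that contains `s`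
  -- is not minimal and must be `m`.
  obtain ⟨t, ht, v, hv, htv, htp⟩ := exists_local_generator (L := Γ(X, X.basicOpen s)) m.asIdeal
    hsm hs (fun q hq hsq hqm => by
      obtain ⟨q₀, hq₀, hle⟩ := Ideal.exists_minimalPrimes_le (I := ⊥) (J := q) bot_le
      have hsq₀ : s ∉ q₀ := fun h =>
        Set.disjoint_left.mp (Ideal.disjoint_nonZeroDivisors_of_mem_minimalPrimes hq₀) h hs
      have h1 : (⟨q₀, hq₀.1.1⟩ : PrimeSpectrum Γ(X, W)) ⤳ ⟨q, hq⟩ :=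
        (PrimeSpectrum.le_iff_specializes _ _).mp hle
      have h2 : (⟨q, hq⟩ : PrimeSpectrum Γ(X, W)) ⤳ m :=
        (PrimeSpectrum.le_iff_specializes _ _).mp hqm
      rcases hX.eq_or_eq (h1.map hW.fromSpec.continuous) (h2.map hW.fromSpec.continuous) with h | h
      · have := congrArg PrimeSpectrum.asIdeal (hW.fromSpec.isOpenEmbedding.injective h)
        exact (hsq₀ (this.ge hsq)).elim
      · exact congrArg PrimeSpectrum.asIdeal (hW.fromSpec.isOpenEmbedding.injective h))
    (h s hs)
  exact isSmoothAt_of_local_generator k m.asIdeal ht hv htv htp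

instance smooth_fromNormalization_preimage [Smooth (U.ι ≫ π)] :
    Smooth ((U.ι.fromNormalization ⁻¹ᵁ U).ι ≫ U.ι.fromNormalization ≫ π) := by
  rw [← Category.assoc, ← morphismRestrict_ι, Category.assoc]
  infer_instance

/-- The smooth locus is open, so closed points suffice. Over `U` smoothness is inherited; elsewhere
the extension property of integral functions produces a local parameter. -/
lemma smooth_normalization [IsAlgClosed k] [LocallyOfFiniteType π] [CompactSpace U.ι.normalization]
    [IsFinite U.ι.fromNormalization] [Smooth (U.ι ≫ π)]
    (hN : PureOneDimensional U.ι.normalization) : Smooth (U.ι.fromNormalization ≫ π) := by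
  have : LocallyOfFinitePresentation (U.ι.fromNormalization ≫ π) :=
    LocallyOfFinitePresentation.iff_locallyOfFiniteType.mpr inferInstance
  rw [← Scheme.Hom.smoothLocus_eq_top_iff]
  refine top_le_iff.mp fun x _ => ?_
  obtain ⟨n, hxn, hn⟩ := (isClosed_closure (s := {x})).exists_closed_singleton
    ⟨x, subset_closure rfl⟩
  refine (specializes_iff_mem_closure.mpr hxn).mem_open
    (U.ι.fromNormalization ≫ π).smoothLocus.2 ?_
  by_cases hnU : n ∈ U.ι.fromNormalization ⁻¹ᵁ U
  · exact le_smoothLocus (U.ι.fromNormalization ≫ π) (U.ι.fromNormalization ⁻¹ᵁ U) hnU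
  obtain ⟨V, hV, hnV, -⟩ := exists_isAffineOpen_mem_and_subset
    (x := U.ι.fromNormalization n) (U := ⊤) trivial
  exact mem_smoothLocus_of_exists_map_eq _ hN (hV.preimage U.ι.fromNormalization) hnV hn
    (dense_fromNormalization_preimage U) hnU fun s hs =>
      exists_map_eq_of_isIntegralElem_normalization U π hV hs

end NormalizationSmooth

/-! ### Modules killed by a power of a maximal ideal -/

section FiniteLength

/-- The only possible prime of the quotient is the image of `m`, so this algebra of finite type has
dimension at most zero. -/
lemma finite_quotient_pow_of_isMaximal (k : Type*) [Field k] {A : Type*} [CommRing A] [Algebra k A]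
    [Algebra.FiniteType k A] (m : Ideal A) [m.IsMaximal] (n : ℕ) : Module.Finite k (A ⧸ m ^ n) := by
  rw [Module.finite_iff_krullDimLE_zero, Ring.krullDimLE_zero_iff]
  intro P hP
  have h1 : m ≤ P.comap (Ideal.Quotient.mk (m ^ n)) := by
    refine Ideal.IsPrime.le_of_pow_le (n := n) ?_
    intro x hx
    rw [Ideal.mem_comap, Ideal.Quotient.eq_zero_iff_mem.mpr hx]
    exact zero_mem P
  have h2 : m = P.comap (Ideal.Quotient.mk (m ^ n)) :=
    Ideal.IsMaximal.eq_of_le ‹_› (Ideal.IsPrime.ne_top inferInstance) h1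
  have h3 : P = m.map (Ideal.Quotient.mk (m ^ n)) := by
    conv_lhs => rw [← Ideal.map_comap_of_surjective _ Ideal.Quotient.mk_surjective P]
    exact congrArg _ h2.symm
  exact h3 ▸ (Ideal.map_eq_top_or_isMaximal_of_surjective _ Ideal.Quotient.mk_surjective
    ‹m.IsMaximal›).resolve_left (h3 ▸ hP.ne_top)

/-- Finitely many generators give a uniform exponent for each `s`, so `m` lies in the radical of the
annihilator; as `m` is finitely generated, a power of it lies in the annihilator. -/
lemma exists_pow_le_annihilator {A Q : Type*} [CommRing A] [IsNoetherianRing A] [AddCommGroup Q]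
    [Module A Q] [Module.Finite A Q] (m : Ideal A) (h : ∀ s ∈ m, ∀ q : Q, ∃ n : ℕ, s ^ n • q = 0) :
    ∃ n, m ^ n ≤ Module.annihilator A Q := by
  refine Ideal.exists_pow_le_of_le_radical_of_fg (fun s hs => ?_) (IsNoetherian.noetherian m)
  choose e he using h s hs
  obtain ⟨S, hS⟩ := Module.Finite.fg_top (R := A) (M := Q)
  refine ⟨S.sup e, Module.mem_annihilator.mpr fun q => ?_⟩
  have hq : q ∈ Submodule.span A (S : Set Q) := hS ▸ Submodule.mem_top
  induction hq using Submodule.span_induction with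
  | mem x hx =>
    rw [← Nat.sub_add_cancel (Finset.le_sup hx : e x ≤ S.sup e), pow_add, mul_smul, he, smul_zero]
  | zero => simp
  | add x y _ _ hx hy => rw [smul_add, hx, hy, add_zero]
  | smul a x _ hx => rw [smul_comm, hx, smul_zero]

lemma finite_of_pow_le_annihilator (k : Type*) [Field k] {A Q : Type*} [CommRing A] [Algebra k A]
    [Algebra.FiniteType k A] (m : Ideal A) [m.IsMaximal] [AddCommGroup Q] [Module A Q] [Module k Q]
    [IsScalarTower k A Q] [Module.Finite A Q] {n : ℕ} (h : m ^ n ≤ Module.annihilator A Q) :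
    Module.Finite k Q := by
  have hQ : Module.IsTorsionBySet A Q (m ^ n : Ideal A) := fun q a =>
    Module.mem_annihilator.mp (h a.2) q
  let := hQ.module
  have : IsScalarTower A (A ⧸ m ^ n) Q := hQ.isScalarTower
  have : IsScalarTower k (A ⧸ m ^ n) Q := hQ.isScalarTower
  have := finite_quotient_pow_of_isMaximal k m n
  have : Module.Finite (A ⧸ m ^ n) Q := .of_restrictScalars_finite A _ _
  exact Module.Finite.trans (A ⧸ m ^ n) Q

end FiniteLength

/-! ### Finite-dimensionality of the quotient sheaf -/

section FiniteDelta

open Opposite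

variable {k : Type u} [Field k] {X Y : Scheme.{u}} (πX : X ⟶ Spec (.of k)) (πY : Y ⟶ Spec (.of k))
  (f : X ⟶ Y) (hf : f ≫ πY = πX)

/-- Over an affine open subset, sections of `f_* 𝒪_X / 𝒪_Y` supported at a point are torsion. -/
lemma exists_pow_mul_eq [IsAffineHom f] {V : Y.Opens} (hV : IsAffineOpen V) (s : Γ(Y, V))
    (hs : Function.Bijective (f.app (Y.basicOpen s))) (b : Γ(X, f ⁻¹ᵁ V)) :
    ∃ (n : ℕ) (a : Γ(Y, V)), f.app V s ^ n * b = f.app V a := by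
  let e : Y.basicOpen s ≤ V := Y.basicOpen_le s
  have e' : f ⁻¹ᵁ Y.basicOpen s ≤ f ⁻¹ᵁ V := (Opens.map f.base).monotone e
  have nat (y : Γ(Y, V)) : f.app (Y.basicOpen s) (Y.presheaf.map (homOfLE e).op y) =
      X.presheaf.map (homOfLE e').op (f.app V y) :=
    congrArg (fun g => g.hom y) (f.naturality (homOfLE e).op)
  have := hV.isLocalization_basicOpen s
  let := ((X.presheaf.map (homOfLE e').op).hom).toAlgebra
  have : IsLocalization.Away (f.app V s) Γ(X, f ⁻¹ᵁ Y.basicOpen s) :=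
    (hV.preimage f).isLocalization_of_eq_basicOpen (f.app V s) (homOfLE e')
      (Scheme.preimage_basicOpen f s)
  obtain ⟨a', ha'⟩ := hs.2 (X.presheaf.map (homOfLE e').op b)
  obtain ⟨n, a, ha⟩ := IsLocalization.Away.surj s a'
  have h1 : f.app (Y.basicOpen s) (a' * Y.presheaf.map (homOfLE e).op s ^ n) =
      f.app (Y.basicOpen s) (Y.presheaf.map (homOfLE e).op a) := congrArg _ ha
  rw [map_mul, map_pow, nat, nat, ha', ← map_pow, ← map_mul] at h1
  obtain ⟨j, hj⟩ := IsLocalization.Away.exists_of_eq (S := Γ(X, f ⁻¹ᵁ Y.basicOpen s))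
    (f.app V s) h1
  refine ⟨j + n, s ^ j * a, ?_⟩
  rw [map_mul, map_pow, ← hj]
  ring

/-- The map from functions near `z` to the stalk of the quotient sheaf. -/
def germDelta (V : Y.Opens) (z : Y) (hz : z ∈ V) :
    sections πX (f ⁻¹ᵁ V) →ₗ[k] (Delta πX πY f hf).presheaf.stalk z :=
  ((Delta πX πY f hf).presheaf.germ V z hz).hom ∘ₗ toDelta πX πY f hf V

lemma germDelta_restriction {U V : Y.Opens} (h : U ≤ V) {z : Y} (hz : z ∈ U)
    (t : Γ(X, f ⁻¹ᵁ V)) : germDelta πX πY f hf U z hz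
      (X.presheaf.map (homOfLE ((Opens.map f.base).monotone h)).op t) =
        germDelta πX πY f hf V z (h hz) t := by
  refine (congrArg ((Delta πX πY f hf).presheaf.germ U z hz) (map_toDelta πX πY f hf h t)).symm.trans
    ?_
  exact (Delta πX πY f hf).presheaf.germ_res_apply (homOfLE h) z hz _

lemma germDelta_app {V : Y.Opens} {z : Y} (hz : z ∈ V) (a : Γ(Y, V)) :
    germDelta πX πY f hf V z hz (f.app V a) = 0 :=
  (congrArg ((Delta πX πY f hf).presheaf.germ V z hz)
    (toDelta_pullbackSections πX πY f hf V a)).trans (map_zero _)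

lemma exists_germDelta_eq {V : Y.Opens} {z : Y} (hz : z ∈ V)
    (t : (Delta πX πY f hf).presheaf.stalk z) : ∃ (W : Y.Opens) (_ : W ≤ V) (hW : z ∈ W)
      (s : Γ(X, f ⁻¹ᵁ W)), germDelta πX πY f hf W z hW s = t := by
  obtain ⟨V₁, hV₁, hz₁, t₁, rfl⟩ := TopCat.Presheaf.exists_le_germ_eq
    (Delta πX πY f hf).presheaf t hz
  obtain ⟨W, hW, hzW, s, hs⟩ := exists_toDelta_eq πX πY f hf V₁ t₁ z hz₁
  refine ⟨W, hW.trans hV₁, hzW, s, ?_⟩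
  refine (congrArg ((Delta πX πY f hf).presheaf.germ W z hzW) hs).trans ?_
  exact (Delta πX πY f hf).presheaf.germ_res_apply (homOfLE hW) z hzW _

/-- The quotient sheaf `f_* 𝒪_X / 𝒪_Y` of a finite morphism has finite-dimensional stalks at
isolated points of its support. -/
lemma finite_stalk_Delta [LocallyOfFiniteType πY] [IsFinite f] {z : Y} (hz : IsClosed {z})
    {V : Y.Opens} (hV : IsAffineOpen V) (hzV : z ∈ V)
    (h : ∀ V' ≤ V, z ∉ V' → Function.Bijective (f.app V')) :
    Module.Finite k ((Delta πX πY f hf).presheaf.stalk z) := by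
  let := (scalars πY V).toAlgebra
  let := (scalars πX (f ⁻¹ᵁ V)).toAlgebra
  let := (f.app V).hom.toAlgebra
  have : IsScalarTower k Γ(Y, V) Γ(X, f ⁻¹ᵁ V) := .of_algebraMap_eq fun c =>
    (app_scalars πX πY f hf V c).symm
  have : Algebra.FiniteType k Γ(Y, V) := finiteType_scalars πY hV
  have : IsNoetherianRing Γ(Y, V) := Algebra.FiniteType.isNoetherianRing k _
  have : Module.Finite Γ(Y, V) Γ(X, f ⁻¹ᵁ V) := f.finite_app V hV
  have hmax := hV.primeIdealOf_isMaximal_of_isClosed ⟨z, hzV⟩ hz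
  have hmz : hV.fromSpec (hV.primeIdealOf ⟨z, hzV⟩) = z := hV.fromSpec_primeIdealOf ⟨z, hzV⟩
  have hmem (s : Γ(Y, V)) : z ∈ Y.basicOpen s ↔ s ∉ (hV.primeIdealOf ⟨z, hzV⟩).asIdeal := by
    rw [← PrimeSpectrum.mem_basicOpen, ← hV.fromSpec_preimage_basicOpen]
    change _ ↔ hV.fromSpec (hV.primeIdealOf ⟨z, hzV⟩) ∈ Y.basicOpen s
    rw [hmz]
  generalize hV.primeIdealOf ⟨z, hzV⟩ = m at *
  let P := LinearMap.range (Algebra.linearMap Γ(Y, V) Γ(X, f ⁻¹ᵁ V))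
  -- For `s ∈ m` the basic open set of `s` misses `z`, so `f` is bijective on functions there and a
  -- power of `s` kills each class. The quotient is thus finite over `k`, and it will be shown to
  -- surject onto the stalk.
  obtain ⟨N, hN⟩ := exists_pow_le_annihilator (Q := Γ(X, f ⁻¹ᵁ V) ⧸ P) m.asIdeal fun s hs q => by
    obtain ⟨b, rfl⟩ := P.mkQ_surjective q
    obtain ⟨n, a, ha⟩ := exists_pow_mul_eq f hV s
      (h _ (Y.basicOpen_le s) fun hz => (hmem s).mp hz hs) b
    refine ⟨n, ?_⟩
    rw [← map_smul]
    refine (Submodule.Quotient.mk_eq_zero P).mpr ⟨a, ?_⟩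
    rw [Algebra.smul_def, map_pow]
    exact ha.symm
  have := finite_of_pow_le_annihilator k m.asIdeal hN
  let ψ : Γ(X, f ⁻¹ᵁ V) →ₗ[k] (Delta πX πY f hf).presheaf.stalk z :=
    { toFun b := germDelta πX πY f hf V z hzV b
      map_add' := (germDelta πX πY f hf V z hzV).map_add
      map_smul' c b := (germDelta πX πY f hf V z hzV).map_smul c b }
  have hψ : Function.Surjective ψ := by
    intro t
    obtain ⟨W, hWV, hzW, t, rfl⟩ := exists_germDelta_eq πX πY f hf hzV t
    obtain ⟨g, hgW, hzg⟩ := hV.exists_basicOpen_le ⟨z, hzW⟩ hzV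
    have e : Y.basicOpen g ≤ V := Y.basicOpen_le g
    have e' : f ⁻¹ᵁ Y.basicOpen g ≤ f ⁻¹ᵁ V := (Opens.map f.base).monotone e
    rw [← germDelta_restriction πX πY f hf hgW hzg]
    generalize X.presheaf.map (homOfLE ((Opens.map f.base).monotone hgW)).op t = t'
    have nat (y : Γ(Y, V)) : f.app (Y.basicOpen g) (Y.presheaf.map (homOfLE e).op y) =
        X.presheaf.map (homOfLE e').op (f.app V y) :=
      congrArg (fun g => g.hom y) (f.naturality (homOfLE e).op)
    let := ((X.presheaf.map (homOfLE e').op).hom).toAlgebra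
    have : IsLocalization.Away (f.app V g) Γ(X, f ⁻¹ᵁ Y.basicOpen g) :=
      (hV.preimage f).isLocalization_of_eq_basicOpen (f.app V g) (homOfLE e')
        (Scheme.preimage_basicOpen f g)
    obtain ⟨n, b, hb⟩ := IsLocalization.Away.surj (f.app V g) t'
    replace hb : t' * X.presheaf.map (homOfLE e').op (f.app V g) ^ n =
      X.presheaf.map (homOfLE e').op b := hb
    obtain ⟨y, i, hi, hyi⟩ := hmax.exists_inv (x := g ^ n) fun hg =>
      (hmem g).mp hzg (m.isPrime.mem_of_pow_mem n hg)
    -- Since `1 - i = y * g ^ n` divides `1 - i ^ N`, the element `y * c` inverts `g ^ n` modulo `m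
    -- ^ N`. As `i ^ N` sends `b` into functions on `Y`, the germ of `t' = b / g ^ n` equals that of
    -- `y * c * b`.
    obtain ⟨c, hc⟩ := sub_dvd_pow_sub_pow 1 i N
    have hc' : y * c * g ^ n + i ^ N = 1 := by
      rw [one_pow] at hc
      linear_combination c * hyi - hc
    obtain ⟨a, ha⟩ := (Submodule.Quotient.mk_eq_zero P).mp
      (Module.mem_annihilator.mp (hN (Ideal.pow_mem_pow hi N)) (P.mkQ b))
    replace ha : f.app V a = f.app V (i ^ N) * b := ha.trans (Algebra.smul_def _ _)
    have := hV.isLocalization_basicOpen g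
    obtain ⟨v, hv⟩ := (IsLocalization.Away.algebraMap_isUnit
      (S := Γ(Y, Y.basicOpen g)) g).exists_right_inv
    replace hv : Y.presheaf.map (homOfLE e).op g * v = 1 := hv
    have hv' := congrArg (f.app (Y.basicOpen g)) hv
    rw [map_mul, nat, map_one] at hv'
    have h1 := congrArg (X.presheaf.map (homOfLE e').op) (congrArg (f.app V) hc')
    have h2 := congrArg (X.presheaf.map (homOfLE e').op) ha
    rw [← nat] at h2
    simp only [map_add, map_mul, map_pow, map_one] at h1 h2
    have h3 : t' = X.presheaf.map (homOfLE e').op (f.app V (y * c) * b) +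
        f.app (Y.basicOpen g) (Y.presheaf.map (homOfLE e).op a * v ^ n) := by
      have hv'' := congrArg (· ^ n) hv'
      simp only [map_mul, map_pow, h2, mul_pow, one_pow, ← hb] at hv'' ⊢
      generalize f.app (Y.basicOpen g) v = v' at *
      generalize X.presheaf.map (homOfLE e').op (f.app V g) = g' at *
      linear_combination (-t') * h1 -
        t' * X.presheaf.map (homOfLE e').op (f.app V i) ^ N * hv''
    refine ⟨f.app V (y * c) * b, ?_⟩
    rw [h3]
    refine (germDelta_restriction πX πY f hf e hzg _).symm.trans ?_
    refine Eq.symm ((map_add (germDelta πX πY f hf _ z hzg) _ _).trans ?_)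
    refine (congrArg _ (germDelta_app πX πY f hf hzg _)).trans (add_zero _)
  let q : Γ(X, f ⁻¹ᵁ V) →ₗ[k] (Γ(X, f ⁻¹ᵁ V) ⧸ P) := P.mkQ.restrictScalars k
  have hq : LinearMap.ker q ≤ LinearMap.ker ψ := by
    intro b hb
    obtain ⟨a, rfl⟩ := (Submodule.Quotient.mk_eq_zero P).mp hb
    exact germDelta_app πX πY f hf hzV a
  have : Module.Finite k (Γ(X, f ⁻¹ᵁ V) ⧸ LinearMap.ker q) :=
    .equiv (q.quotKerEquivOfSurjective P.mkQ_surjective).symm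
  refine Module.Finite.of_surjective ((LinearMap.ker q).liftQ ψ hq) fun t => ?_
  obtain ⟨b, rfl⟩ := hψ t
  exact ⟨Submodule.Quotient.mk b, rfl⟩

/-- A section is determined by its germs, of which only those in the finitely many nonzero stalks
matter. -/
lemma finite_globalSections_Delta
    (h : {x : Y | ¬ Subsingleton ((Delta πX πY f hf).presheaf.stalk x)}.Finite)
    (h' : ∀ x : Y, Module.Finite k ((Delta πX πY f hf).presheaf.stalk x)) :
    Module.Finite k ((globalSections Y).obj (Delta πX πY f hf)) := by
  let S := {x : Y | ¬ Subsingleton ((Delta πX πY f hf).presheaf.stalk x)}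
  have : Finite S := h
  let φ : (globalSections Y).obj (Delta πX πY f hf) →ₗ[k]
      ((x : S) → (Delta πX πY f hf).presheaf.stalk x.1) :=
    LinearMap.pi fun x => ((Delta πX πY f hf).presheaf.germ ⊤ x.1 trivial).hom
  refine Module.Finite.of_injective φ ((injective_iff_map_eq_zero φ).mpr fun t ht => ?_)
  refine eq_zero_of_locally_eq_zero (Delta πX πY f hf) ⊤ t fun x _ => ?_
  refine exists_map_eq_zero_of_germ_eq_zero ⊤ t x trivial ?_
  by_cases hx : Subsingleton ((Delta πX πY f hf).presheaf.stalk x)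
  · exact @Subsingleton.elim _ hx _ _
  · exact congrFun ht ⟨x, hx⟩

end FiniteDelta

/-! ### The normalization of a curve as an equinormalized curve -/

section Existence

/-- A finite closed subset of a proper scheme is the image of a closed subscheme finite over the
base field. -/
lemma exists_isClosedImmersion_range_eq {k : Type u} [Field k] {X : Scheme.{u}}
    (π : X ⟶ Spec (.of k)) [LocallyOfFiniteType π] [CompactSpace X] {K : Set X}
    (hK : IsClosed K) (hf : K.Finite) : ∃ (Z : Scheme.{u}) (i : Z ⟶ X), IsClosedImmersion i ∧
      IsFinite (i ≫ π) ∧ Set.range i = K := by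
  let I := Scheme.IdealSheafData.vanishingIdeal (X := X) ⟨K, hK⟩
  have hr : Set.range I.subschemeι = K := by
    rw [Scheme.IdealSheafData.range_subschemeι, Scheme.IdealSheafData.coe_support_vanishingIdeal]
    rfl
  refine ⟨I.subscheme, I.subschemeι, inferInstance, ?_, hr⟩
  have : QuasiCompact π := (quasiCompact_iff_compactSpace π).mpr inferInstance
  have hfin : Finite I.subscheme := by
    refine Set.finite_univ_iff.mp (Set.Finite.of_finite_image (f := I.subschemeι) ?_
      I.subschemeι.isClosedEmbedding.injective.injOn)
    rw [Set.image_univ, hr]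
    exact hf
  have : LocallyQuasiFinite (I.subschemeι ≫ π) :=
    LocallyQuasiFinite.of_finite_preimage_singleton _ fun _ => Set.toFinite _
  exact IsFinite.of_locallyQuasiFinite _

variable {k : Type u} [Field k] [IsAlgClosed k] {g n : ℕ}

instance Curve.isNoetherian (Y : Curve k g) : IsNoetherian Y.C :=
  { __ := LocallyOfFiniteType.isLocallyNoetherian Y.π
    __ := (quasiCompact_iff_compactSpace Y.π).mp inferInstance }

lemma Curve.dense_smoothLocus (Y : Curve k g) : Dense (Y.π.smoothLocus : Set Y.C) :=
  Y.π.dense_smoothLocus_of_perfectField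

lemma Curve.isClosed_singleton (Y : Curve k g) {x : Y.C} (hx : x ∉ Y.π.smoothLocus) :
    IsClosed {x} :=
  Y.pure.isClosed_singleton Y.π.smoothLocus.2 Y.dense_smoothLocus hx

lemma Curve.finite_compl_smoothLocus (Y : Curve k g) :
    ((Y.π.smoothLocus : Set Y.C)ᶜ).Finite :=
  finite_of_forall_isClosed_singleton Y.π.smoothLocus.2.isClosed_compl
    fun _ hx => Y.isClosed_singleton hx

/-- The normalization of a curve. -/
def Curve.normalization (Y : Curve k g) : Scheme.{u} := Y.π.smoothLocus.ι.normalization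

/-- The normalization morphism of a curve. -/
def Curve.fromNormalization (Y : Curve k g) : Y.normalization ⟶ Y.C :=
  Y.π.smoothLocus.ι.fromNormalization

/-- The inclusion of the smooth locus into the normalization. -/
def Curve.toNormalization (Y : Curve k g) : Y.π.smoothLocus.toScheme ⟶ Y.normalization :=
  Y.π.smoothLocus.ι.toNormalization

lemma Curve.toNormalization_fromNormalization (Y : Curve k g) :
    Y.toNormalization ≫ Y.fromNormalization = Y.π.smoothLocus.ι :=
  Y.π.smoothLocus.ι.toNormalization_fromNormalization

instance Curve.isFinite_fromNormalization (Y : Curve k g) : IsFinite Y.fromNormalization :=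
  EquinormalizedCurves.isFinite_fromNormalization _ Y.π Y.dense_smoothLocus

instance Curve.isNoetherian_normalization (Y : Curve k g) : IsNoetherian Y.normalization :=
  { __ := LocallyOfFiniteType.isLocallyNoetherian (Y.fromNormalization ≫ Y.π)
    __ := (quasiCompact_iff_compactSpace (Y.fromNormalization ≫ Y.π)).mp inferInstance }

lemma Curve.pure_normalization (Y : Curve k g) : PureOneDimensional Y.normalization :=
  have : IsFinite Y.π.smoothLocus.ι.fromNormalization := Y.isFinite_fromNormalization
  have : NoetherianSpace Y.π.smoothLocus.ι.normalization :=
    inferInstanceAs (NoetherianSpace Y.normalization)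
  pureOneDimensional_normalization _ Y.pure

instance Curve.smooth_normalization (Y : Curve k g) : Smooth (Y.fromNormalization ≫ Y.π) :=
  have : IsFinite Y.π.smoothLocus.ι.fromNormalization := Y.isFinite_fromNormalization
  have : CompactSpace Y.π.smoothLocus.ι.normalization :=
    inferInstanceAs (CompactSpace Y.normalization)
  have := smooth_smoothLocus_ι Y.π
  EquinormalizedCurves.smooth_normalization _ Y.π Y.pure_normalization

lemma Curve.bijective_fromNormalization_app (Y : Curve k g) {V : Y.C.Opens}
    (hV : V ≤ Y.π.smoothLocus) : Function.Bijective (Y.fromNormalization.app V) :=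
  EquinormalizedCurves.bijective_fromNormalization_app _ hV

lemma Curve.subsingleton_stalk_Delta (Y : Curve k g) {x : Y.C} (hx : x ∈ Y.π.smoothLocus) :
    Subsingleton ((Delta (Y.fromNormalization ≫ Y.π) Y.π Y.fromNormalization rfl).presheaf.stalk x) :=
  subsingleton_stalk_of_bijective_app _ _ _ _ (fun _ hV => Y.bijective_fromNormalization_app hV) hx

lemma Curve.finite_Delta (Y : Curve k g) : Module.Finite k
    ((globalSections Y.C).obj (Delta (Y.fromNormalization ≫ Y.π) Y.π Y.fromNormalization rfl)) := by
  refine finite_globalSections_Delta _ _ _ _ (Y.finite_compl_smoothLocus.subset fun x hx hxU =>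
    hx (Y.subsingleton_stalk_Delta hxU)) fun x => ?_
  by_cases hx : x ∈ Y.π.smoothLocus
  · have := Y.subsingleton_stalk_Delta hx
    infer_instance
  -- Removing the other nonsmooth points, finitely many and closed, isolates `x` as
  -- `finite_stalk_Delta` requires.
  let W : Y.C.Opens := ⟨((Y.π.smoothLocus : Set Y.C)ᶜ \ {x})ᶜ, by
    rw [isOpen_compl_iff, ← Set.biUnion_of_singleton ((Y.π.smoothLocus : Set Y.C)ᶜ \ {x})]
    exact (Y.finite_compl_smoothLocus.sdiff).isClosed_biUnion
      fun y hy => Y.isClosed_singleton hy.1⟩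
  have hxW : x ∈ W := fun h => h.2 rfl
  obtain ⟨V, hV, hxV, hVW⟩ := exists_isAffineOpen_mem_and_subset hxW
  refine finite_stalk_Delta _ _ _ _ (Y.isClosed_singleton hx) hV hxV fun V' hV' hxV' =>
    Y.bijective_fromNormalization_app fun y hy => ?_
  by_contra h
  exact hVW (hV' hy) ⟨h, fun e => hxV' (e ▸ hy)⟩

/-- The equinormalized curve given by the normalization of a curve with smooth distinct markings. -/
def PointedCurve.normalize (Y : PointedCurve k g n) (hY : smoothU k g n Y) :
    EquinormalizedCurve k g n where
  toCurve := Y.toCurve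
  Ct := Y.normalization
  πt := Y.fromNormalization ≫ Y.π
  pure_t := Y.pure_normalization
  -- A smooth marking factors through the smooth locus, which sits inside the normalization.
  p i := IsOpenImmersion.lift Y.π.smoothLocus.ι (Y.q i) (by simpa using hY.1 i) ≫ Y.toNormalization
  p_πt i := by
    rw [Category.assoc, reassoc_of% Y.toNormalization_fromNormalization,
      IsOpenImmersion.lift_fac_assoc, Y.q_π]
  disjoint i j hij := by
    have h := Set.disjoint_left.mp (hY.2 hij)
    refine Set.disjoint_left.mpr ?_
    rintro _ ⟨a, rfl⟩ ⟨b, hb⟩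
    refine h ⟨a, rfl⟩ ⟨b, ?_⟩
    have := congrArg Y.fromNormalization hb
    rwa [← Scheme.Hom.comp_apply, ← Scheme.Hom.comp_apply, Category.assoc, Category.assoc,
      Y.toNormalization_fromNormalization, IsOpenImmersion.lift_fac,
      IsOpenImmersion.lift_fac] at this
  ν := Y.fromNormalization
  ν_π := rfl
  injective := EquinormalizedCurves.injective_fromNormalization_app _ Y.dense_smoothLocus
  support := by
    obtain ⟨Z, i, hi, hfin, hr⟩ := exists_isClosedImmersion_range_eq Y.π
      Y.π.smoothLocus.2.isClosed_compl Y.finite_compl_smoothLocus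
    refine ⟨Z, i, hi, hfin, fun x hx => Y.subsingleton_stalk_Delta ?_⟩
    rw [hr] at hx
    exact not_not.mp hx
  finite_Delta := Y.finite_Delta

lemma PointedCurve.normalize_q (Y : PointedCurve k g n) (hY : smoothU k g n Y) (i : Fin n) :
    ((EquinormalizedCurve.toPointedCurve k g n).obj (Y.normalize hY)).q i = Y.q i := by
  change (IsOpenImmersion.lift Y.π.smoothLocus.ι (Y.q i) _ ≫ Y.toNormalization) ≫
    Y.fromNormalization = _
  rw [Category.assoc, Y.toNormalization_fromNormalization, IsOpenImmersion.lift_fac]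

/-- A pointed curve with smooth distinct markings underlies its normalization. -/
def PointedCurve.normalizeIso (Y : PointedCurve k g n) (hY : smoothU k g n Y) :
    (EquinormalizedCurve.toPointedCurve k g n).obj (Y.normalize hY) ≅ Y where
  hom :=
    { iso := Iso.refl Y.C
      iso_π := Category.id_comp _
      q_iso i := (Category.comp_id _).trans (Y.normalize_q hY i) }
  inv :=
    { iso := Iso.refl Y.C
      iso_π := Category.id_comp _
      q_iso i := (Category.comp_id _).trans (Y.normalize_q hY i).symm }
  hom_inv_id := PointedCurve.Hom.ext (Iso.self_symm_id _)
  inv_hom_id := PointedCurve.Hom.ext (Iso.self_symm_id _)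

end Existence

/-! ### Lifting isomorphisms and counting markings -/

namespace EquinormalizedCurve

variable {k : Type u} [Field k] [IsAlgClosed k] {g n : ℕ}

instance (X : EquinormalizedCurve k g n) : IsReduced X.Ct := isReduced_of_smooth X.πt

/-- The normalization is an isomorphism outside finitely many closed points. -/
lemma exists_bijective_app (X : EquinormalizedCurve k g n) :
    ∃ U : X.C.Opens, (∀ x ∉ U, IsClosed {x}) ∧ ∀ V ≤ U, Function.Bijective (X.ν.app V) := by
  obtain ⟨Z, i, hi, hfin, hs⟩ := X.support
  refine ⟨⟨(Set.range i)ᶜ, i.isClosedEmbedding.isClosed_range.isOpen_compl⟩, fun x hx => ?_,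
    fun V hV => bijective_app_of_subsingleton_stalk _ _ _ X.ν_π X.injective V
      fun x hx => hs x (hV hx)⟩
  obtain ⟨z, rfl⟩ := not_not.mp hx
  have hz : IsClosed {z} := isClosed_singleton_of_locallyQuasiFinite (i ≫ X.π) <| by
    rw [Set.eq_univ_of_forall (s := {(i ≫ X.π) z}) fun y => Subsingleton.elim _ _]
    exact isClosed_univ
  simpa using i.isClosedEmbedding.isClosedMap _ hz

/-- Points over closed points are closed since `ν` is finite, and the purity of `C̃` prevents closed
points from being generic. -/
lemma dense_preimage (X : EquinormalizedCurve k g n) {U : Set X.C}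
    (h : ∀ x ∉ U, IsClosed {x}) : Dense (X.ν ⁻¹' U) :=
  X.pure_t.dense fun _ hx => isClosed_singleton_of_locallyQuasiFinite X.ν (h _ hx)

/-- A priori the support of `Δ` could contain smooth points of `C`; normality of the smooth locus
excludes this. -/
instance (X : EquinormalizedCurve k g n) : IsIso (X.ν ∣_ X.π.smoothLocus) := by
  obtain ⟨U, hU, h⟩ := X.exists_bijective_app
  exact isIso_morphismRestrict_smoothLocus X.ν X.π (X.pure.dense hU) (X.dense_preimage hU) h

/-- An isomorphism of curves over `k` lifts to the normalizations. -/
lemma exists_iso (X Y : EquinormalizedCurve k g n) (φ : X.C ≅ Y.C) :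
    ∃ e : X.Ct ≅ Y.Ct, e.hom ≫ Y.ν = X.ν ≫ φ.hom := by
  obtain ⟨U, hU, h⟩ := X.exists_bijective_app
  obtain ⟨V, hV, h'⟩ := Y.exists_bijective_app
  -- Over this common open set both `X.ν ≫ φ.hom` and `Y.ν` are isomorphisms, so both are the
  -- normalization of `Y.C` in it.
  have hW : ∀ y ∉ (V ⊓ φ.inv ⁻¹ᵁ U : Y.C.Opens), IsClosed {y} := fun y hy => by
    by_cases hyV : y ∈ V
    · have hyU : φ.inv y ∉ U := fun hyU => hy ⟨hyV, hyU⟩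
      simpa using φ.hom.homeomorph.isClosedMap _ (hU _ hyU)
    · exact hV y hyV
  refine exists_iso_of_bijective (X.ν ≫ φ.hom) X.πt Y.ν Y.πt (U := V ⊓ φ.inv ⁻¹ᵁ U) ?_ ?_
    (Y.dense_preimage hW) fun W hW => h' W (hW.trans inf_le_left)
  · refine X.dense_preimage (U := φ.hom ⁻¹' (V ⊓ φ.inv ⁻¹ᵁ U : Y.C.Opens)) fun x hx => ?_
    exact isClosed_singleton_of_locallyQuasiFinite φ.hom (hW _ hx)
  · intro W hW
    rw [Scheme.Hom.comp_app]
    refine (h _ fun x hx => ?_).comp (ConcreteCategory.bijective_of_isIso (φ.hom.app W))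
    simpa using (hW hx).2

lemma πt_of_comp_ν {X Y : EquinormalizedCurve k g n} {φ : X.C ⟶ Y.C} {e : X.Ct ⟶ Y.Ct}
    (he : e ≫ Y.ν = X.ν ≫ φ) (hφ : φ ≫ Y.π = X.π) : e ≫ Y.πt = X.πt := by
  rw [← Y.ν_π, ← X.ν_π, reassoc_of% he, hφ]

/-- Two lifts of one isomorphism agree where `Y.ν` is an isomorphism, a locus with dense preimage,
hence everywhere by separatedness. -/
instance : (toPointedCurve k g n).Faithful where
  map_injective {X Y f f'} h := by
    have hiso : f.iso = f'.iso := congrArg PointedCurve.Hom.iso h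
    refine Hom.ext (Iso.ext ?_) hiso
    obtain ⟨U, hU, h'⟩ := Y.exists_bijective_app
    have := isIso_morphismRestrict_of_bijective Y.ν U h'
    refine eq_of_comp_eq_of_isIso_restrict Y.ν U (by rw [f.iso_ν, f'.iso_ν, hiso]) ?_
    exact (Y.dense_preimage hU).preimage f.iso_t.hom.homeomorph.isOpenMap

lemma eq_of_comp_ν_eq (X : EquinormalizedCurve k g n) {a b : Spec (.of k) ⟶ X.Ct}
    (h : a ≫ X.ν = b ≫ X.ν) (ha : Set.range (a ≫ X.ν) ⊆ (X.π.smoothLocus : Set X.C)) : a = b := by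
  refine eq_of_comp_eq_of_isIso_restrict X.ν X.π.smoothLocus h ?_
  rw [Set.eq_univ_of_forall (s := ((a ≫ X.ν) ⁻¹ᵁ X.π.smoothLocus : Set (Spec (.of k))))
    fun x => ha ⟨x, rfl⟩]
  exact dense_univ

lemma ν_injOn (X : EquinormalizedCurve k g n) {x y : X.Ct} (h : X.ν x = X.ν y)
    (hx : X.ν x ∈ X.π.smoothLocus) : x = y := by
  have hinj := (X.ν ∣_ X.π.smoothLocus).homeomorph.injective
  have hy : X.ν y ∈ X.π.smoothLocus := by rwa [← h]
  have hxy : (X.ν ∣_ X.π.smoothLocus) ⟨x, hx⟩ = (X.ν ∣_ X.π.smoothLocus) ⟨y, hy⟩ :=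
    Subtype.ext ((morphismRestrict_base_coe _ _ _).trans
      (h.trans (morphismRestrict_base_coe X.ν X.π.smoothLocus ⟨y, hy⟩).symm))
  have := hinj hxy
  exact congrArg Subtype.val this

lemma smoothU_of_smoothE (X : EquinormalizedCurve k g n) (hX : smoothE k g n X) :
    smoothU k g n ((toPointedCurve k g n).obj X) := by
  refine ⟨hX, fun i j hij => Set.disjoint_left.mpr ?_⟩
  rintro _ ⟨a, rfl⟩ ⟨b, hb⟩
  refine Set.disjoint_left.mp (X.disjoint hij) ⟨a, rfl⟩ ⟨b, ?_⟩
  exact X.ν_injOn hb (hX j ⟨b, rfl⟩)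

/-- An isomorphism of underlying pointed curves lifts when the markings are smooth. -/
lemma exists_map_eq {X Y : EquinormalizedCurve k g n} (hY : smoothE k g n Y)
    (f : (toPointedCurve k g n).obj X ⟶ (toPointedCurve k g n).obj Y) :
    ∃ F : X ⟶ Y, (toPointedCurve k g n).map F = f := by
  obtain ⟨e, he⟩ := X.exists_iso Y f.iso
  have hq (i : Fin n) : (X.p i ≫ e.hom) ≫ Y.ν = Y.p i ≫ Y.ν := by
    rw [Category.assoc, he, ← Category.assoc]
    exact f.q_iso i
  exact ⟨⟨e, f.iso, πt_of_comp_ν he f.iso_π, f.iso_π, he,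
    fun i => Y.eq_of_comp_ν_eq (hq i) (by rw [hq]; exact hY i)⟩, rfl⟩

/-- Two equinormalized curves over the same pointed curve are isomorphic when their markings
correspond. -/
lemma nonempty_iso {X X' X₀ : EquinormalizedCurve k g n} {φ : X.C ≅ X₀.C} {φ' : X'.C ≅ X₀.C}
    (hφ : φ.hom ≫ X₀.π = X.π) (hφ' : φ'.hom ≫ X₀.π = X'.π)
    {e : X.Ct ≅ X₀.Ct} {e' : X'.Ct ≅ X₀.Ct} (he : e.hom ≫ X₀.ν = X.ν ≫ φ.hom)
    (he' : e'.hom ≫ X₀.ν = X'.ν ≫ φ'.hom) (h : ∀ i, X.p i ≫ e.hom = X'.p i ≫ e'.hom) :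
    Nonempty (X ≅ X') := by
  have hπ : (φ ≪≫ φ'.symm).hom ≫ X'.π = X.π := by simp [← hφ, ← hφ']
  have hν : (e ≪≫ e'.symm).hom ≫ X'.ν = X.ν ≫ (φ ≪≫ φ'.symm).hom := by
    have : e'.inv ≫ X'.ν = X₀.ν ≫ φ'.inv := by
      rw [Iso.inv_comp_eq, ← Category.assoc, he', Category.assoc, Iso.hom_inv_id,
        Category.comp_id]
    simp [this, reassoc_of% he]
  have hp (i : Fin n) : X.p i ≫ (e ≪≫ e'.symm).hom = X'.p i := by
    simp [reassoc_of% h i]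
  let F : X ⟶ X' := ⟨e ≪≫ e'.symm, φ ≪≫ φ'.symm, πt_of_comp_ν hν hπ, hπ, hν, hp⟩
  let G : X' ⟶ X := ⟨(e ≪≫ e'.symm).symm, (φ ≪≫ φ'.symm).symm,
    by rw [Iso.symm_hom, Iso.inv_comp_eq, F.iso_πt], by rw [Iso.symm_hom, Iso.inv_comp_eq, F.iso_π],
    by rw [Iso.symm_hom, Iso.inv_comp_eq, ← Category.assoc, hν, Category.assoc, Iso.symm_hom,
      Iso.hom_inv_id, Category.comp_id],
    fun i => by rw [← hp i, Category.assoc, Iso.symm_hom, Iso.hom_inv_id, Category.comp_id]⟩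
  exact ⟨⟨F, G, Hom.ext (Iso.self_symm_id _) (Iso.self_symm_id _),
    Hom.ext (Iso.symm_self_id _) (Iso.symm_self_id _)⟩⟩

/-- Up to isomorphism, finitely many equinormalized curves lie over a pointed curve. -/
lemma finite_isomorphismClasses (Y : PointedCurve k g n) :
    {c : Quotient (isIsomorphicSetoid (EquinormalizedCurve k g n)) |
      ∃ X : EquinormalizedCurve k g n, Quotient.mk _ X = c ∧
        Nonempty ((toPointedCurve k g n).obj X ≅ Y)}.Finite := by
  by_cases hne : ∃ X₀ : EquinormalizedCurve k g n, Nonempty ((toPointedCurve k g n).obj X₀ ≅ Y)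
  swap
  · refine Set.finite_empty.subset ?_
    rintro _ ⟨X, -, hX⟩
    exact hne ⟨X, hX⟩
  obtain ⟨X₀, ⟨α₀⟩⟩ := hne
  let pt : Spec (.of k) := IsLocalRing.closedPoint k
  have key (c : Quotient (isIsomorphicSetoid (EquinormalizedCurve k g n)))
      (hc : ∃ X : EquinormalizedCurve k g n, Quotient.mk _ X = c ∧
        Nonempty ((toPointedCurve k g n).obj X ≅ Y)) :
      ∃ (t : Fin n → X₀.Ct) (X : EquinormalizedCurve k g n) (φ : X.C ≅ X₀.C) (e : X.Ct ≅ X₀.Ct),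
        Quotient.mk _ X = c ∧ φ.hom ≫ X₀.π = X.π ∧ e.hom ≫ X₀.ν = X.ν ≫ φ.hom ∧
        (∀ i, X₀.ν (t i) = (X₀.p i ≫ X₀.ν) pt) ∧ ∀ i, t i = (X.p i ≫ e.hom) pt := by
    obtain ⟨X, hX, ⟨α⟩⟩ := hc
    let f := (α ≪≫ α₀.symm).hom
    obtain ⟨e, he⟩ := X.exists_iso X₀ f.iso
    refine ⟨fun i => (X.p i ≫ e.hom) pt, X, f.iso, e, hX, f.iso_π, he, fun i => ?_, fun _ => rfl⟩
    refine (Scheme.Hom.comp_apply _ _ _).symm.trans ?_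
    rw [Category.assoc, he, ← Category.assoc]
    exact congrArg (fun q : Spec (.of k) ⟶ X₀.C => q pt) (f.q_iso i)
  choose t X φ e hX hφ he hν ht using key
  -- `T` is finite because `ν` has finite fibres. The tuple of a class depends on the chosen
  -- identification with `X₀`, but equal tuples already force an isomorphism.
  let T := {t : Fin n → X₀.Ct | ∀ i, t i ∈ X₀.ν ⁻¹' {(X₀.p i ≫ X₀.ν) pt}}
  have : Finite T :=
    (Set.Finite.pi' fun i => X₀.ν.finite_preimage_singleton ((X₀.p i ≫ X₀.ν) pt)).to_subtype
  refine Set.finite_coe_iff.mp (Finite.of_injective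
    (fun c => (⟨t c.1 c.2, hν c.1 c.2⟩ : T)) fun c c' h => Subtype.ext ?_)
  obtain ⟨c, hc⟩ := c
  obtain ⟨c', hc'⟩ := c'
  refine (hX c hc).symm.trans (Eq.trans (Quotient.sound (nonempty_iso (hφ c hc) (hφ c' hc')
    (he c hc) (he c' hc') fun i => ?_)) (hX c' hc'))
  -- A `k`-point is determined by the point it hits, so equality of points gives equality of the
  -- transported markings.
  refine ext_of_apply_closedPoint_eq X₀.πt ?_ ?_ ?_
  · rw [Category.assoc, πt_of_comp_ν (he c hc) (hφ c hc), (X c hc).p_πt]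
  · rw [Category.assoc, πt_of_comp_ν (he c' hc') (hφ c' hc'), (X c' hc').p_πt]
  · exact (ht c hc i).symm.trans ((congrFun (congrArg Subtype.val h) i).trans (ht c' hc' i))

end EquinormalizedCurve

end EquinormalizedCurves
end

/-! ### Assembly of the two statements -/

open EquinormalizedCurves in
theorem mainTheorem12 (k : Type u) [Field k] [IsAlgClosed k] (g n : ℕ) (hgn : 3 ≤ 3 * g + n) :
    (∀ Y : PointedCurve k g n,
      {c : Quotient (isIsomorphicSetoid (EquinormalizedCurve k g n)) |
        ∃ X : EquinormalizedCurve k g n, Quotient.mk _ X = c ∧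
          Nonempty ((EquinormalizedCurve.toPointedCurve k g n).obj X ≅ Y)}.Finite) ∧
    ∃ h : ∀ X : (smoothE k g n).FullSubcategory,
        smoothU k g n ((EquinormalizedCurve.toPointedCurve k g n).obj X.obj),
      ((smoothU k g n).lift ((smoothE k g n).ι ⋙ EquinormalizedCurve.toPointedCurve k g n)
        h).IsEquivalence := by
  refine ⟨EquinormalizedCurve.finite_isomorphismClasses,
    fun X => X.obj.smoothU_of_smoothE X.property, ?_⟩
  -- The lifted isomorphism respects the markings because a smooth `k`-point of the target has only
  -- one preimage.
  have : ((smoothE k g n).ι ⋙ EquinormalizedCurve.toPointedCurve k g n).Full := ⟨fun {X Y} f => by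
    obtain ⟨F, hF⟩ := EquinormalizedCurve.exists_map_eq Y.property f
    exact ⟨ObjectProperty.homMk F, hF⟩⟩
  refine { essSurj := ⟨fun Y => ?_⟩ }
  have hN : smoothE k g n (Y.obj.normalize Y.property) := fun i => by
    rw [Y.obj.normalize_q Y.property i]
    exact Y.property.1 i
  exact ⟨⟨Y.obj.normalize Y.property, hN⟩,
    ⟨(smoothU k g n).isoMk (Y.obj.normalizeIso Y.property)⟩⟩
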